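/- Consider a generalized Pólya urn with $q\ge2$ colours: $a_1,\dots,a_q\ge0$ are given activities, $X_0\in\mathbb R^q$ is a nonrandom initial composition, and $\xi_1,\dots,\xi_q$ are random vectors in $\mathbb R^q$ (the replacement vectors; entries may be non-integer or negative). The composition $X_n=(X_{n1},\dots,X_{nq})$ evolves as follows: given everything that has happened up to time $n$, a ball of colour $i$ is drawn with probability $a_iX_{ni}/\sum_j a_jX_{nj}$, and if colour $i$ is drawn then $X_{n+1}-X_n$ is a copy of $\xi_i$ independent of everything that has happened so far. Assume that the urn is tenable (for every $n\ge0$, a.s. all $X_{ni}\ge0$ and $\sum_i a_iX_{ni}>0$) and balanced (there is a constant $b>0$ with $\sum_j a_j\xi_{ij}=b$ a.s. for every $i$). Let $p\ge2$ be a real number such that $$\mathbb E|\xi_{ij}|^p<\infty\qquad\text{for all } i,j\in\{1,\dots,q\}.$$ Let $A:=(a_j\,\mathbb E\,\xi_{ji})_{i,j=1}^q$ be the intensity matrix. For an eigenvalue $\lambda$ of $A$ let $\nu_\lambda+1$ be the size of the largest Jordan block of $A$ with eigenvalue $\lambda$. Let $\lambda_1,\dots,\lambda_q$ be the eigenvalues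 of $A$, repeated according to algebraic multiplicity and ordered so that $\operatorname{Re}\lambda_1\ge\operatorname{Re}\lambda_2\ge\cdots$ and, among eigenvalues with equal real parts, so that $\nu_{\lambda_j}$ is decreasing; put $\nu_2:=\nu_{\lambda_2}$. Assume that $\lambda_1=b$. Let $\Sigma$ be a (positive semidefinite) covariance matrix. (i) Suppose that $\operatorname{Re}\lambda_2<\lambda_1/2$ and that, as $n\to\infty$, $$\frac{X_n-\mathbb E X_n}{\sqrt n}\overset{d}{\longrightarrow}N(0,\Sigma).$$ Then this holds with convergence of all moments of order $\le p$. In particular, $\operatorname{Cov}[X_n]/n\to\Sigma$. (ii) Suppose that $\operatorname{Re}\lambda_2=\lambda_1/2$ and that, as $n\to\infty$, $$\frac{X_n-\mathbb E X_n}{\sqrt{n(\log n)^{2\nu_2+1}}}\overset{d}{\longrightarrow}N(0,\Sigma).$$ Then this holds with convergence of all moments of order $\le p$. In particular, $\operatorname{Cov}[X_n]/\bigl(n(\log n)^{2\nu_2+1}\bigr)\to\Sigma$. Here, if $Z_n$ denotes the normalized vector on the left-hand side and $Z\sim N(0,\Sigma)$, convergence of all moments of order $\le p$ means that $Z_n$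 and $Z$ have finite $p$-th absolute moments and that, as $n\to\infty$: $\mathbb E\prod_i Z_{ni}^{k_i}\to\mathbb E\prod_i Z_i^{k_i}$ for all integers $k_i\ge0$ with $\sum_i k_i\le p$; $\mathbb E|Z_n|^r\to\mathbb E|Z|^r$ (Euclidean norm) for all real $0<r\le p$; and $\mathbb E\prod_i|Z_{ni}|^{r_i}\to\mathbb E\prod_i|Z_i|^{r_i}$ for all real $r_i\ge0$ with $\sum_i r_i\le p$. -/

import Mathlib

open MeasureTheory ProbabilityTheory Filter
open scoped Topology

noncomputable section

/-- The data of a (generalized) Pólya urn with colours `Fin q`: the nonrandom initial composition,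
the activities, and the laws of the (random) replacement vectors `ξ i`. -/
structure PolyaUrn (q : ℕ) where
  /-- The initial composition. -/
  initial : EuclideanSpace ℝ (Fin q)
  /-- The activities of the colours. -/
  activity : Fin q → ℝ
  activity_nonneg : ∀ i, 0 ≤ activity i
  /-- `replacement i` is the law of the replacement vector `ξ i`. -/
  replacement : Fin q → ProbabilityMeasure (EuclideanSpace ℝ (Fin q))

namespace PolyaUrn

variable {q : ℕ}

/-- The total activity of an urn with composition `x`. -/
def weight (U : PolyaUrn q) (x : EuclideanSpace ℝ (Fin q)) : ℝ :=
  ∑ j, U.activity j * x j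

/-- The probability that a ball drawn from an urn with composition `x` has colour `i`. -/
def drawProb (U : PolyaUrn q) (x : EuclideanSpace ℝ (Fin q)) (i : Fin q) : ℝ :=
  U.activity i * x i / U.weight x

/-- The urn is balanced: every draw adds the same nonrandom activity `b > 0`. -/
def IsBalanced (U : PolyaUrn q) (b : ℝ) : Prop :=
  0 < b ∧ ∀ i, ∀ᵐ x ∂(U.replacement i : Measure (EuclideanSpace ℝ (Fin q))), U.weight x = b

/-- All replacements have a finite `p`-th absolute moment. -/
def HasFiniteMoments (U : PolyaUrn q) (p : ℝ) : Prop :=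
  ∀ i j, Integrable (fun x : EuclideanSpace ℝ (Fin q) => |x j| ^ p)
    (U.replacement i : Measure (EuclideanSpace ℝ (Fin q)))

/-- The intensity matrix, with `(i, j)` entry `a j * 𝔼 (ξ j) i`. -/
def intensity (U : PolyaUrn q) : Matrix (Fin q) (Fin q) ℝ :=
  Matrix.of fun i j => U.activity j *
    ∫ x, x i ∂(U.replacement j : Measure (EuclideanSpace ℝ (Fin q)))

/-- The intensity matrix as a complex matrix. -/
def intensityC (U : PolyaUrn q) : Matrix (Fin q) (Fin q) ℂ :=
  U.intensity.map (algebraMap ℝ ℂ)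

end PolyaUrn

/-- Everything that has happened up to time `n`: the compositions `X 0, …, X n` and the colours
`I 0, …, I (n - 1)` of the `n` balls drawn so far. -/
abbrev urnHistory {q : ℕ} {Ω : Type*} (X : ℕ → Ω → EuclideanSpace ℝ (Fin q)) (I : ℕ → Ω → Fin q)
    (n : ℕ) : MeasurableSpace Ω :=
  (⨆ k ≤ n, MeasurableSpace.comap (X k) inferInstance) ⊔
    (⨆ k < n, MeasurableSpace.comap (I k) inferInstance)

/-- `X n` is the composition of the urn `U` at time `n`, and `I n` is the colour of the ball drawn
from the urn at time `n` (which turns `X n` into `X (n + 1)`). Given the past, colour `i` is drawn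
with probability `U.drawProb (X n) i`, and if colour `i` is drawn then the increment
`X (n + 1) - X n` is distributed as `ξ i`, independently of the past. -/
structure IsPolyaUrnProcess {q : ℕ} {Ω : Type*} [MeasurableSpace Ω] (U : PolyaUrn q)
    (P : Measure Ω) (X : ℕ → Ω → EuclideanSpace ℝ (Fin q)) (I : ℕ → Ω → Fin q) : Prop where
  measurable_composition : ∀ n, Measurable (X n)
  measurable_draw : ∀ n, Measurable (I n)
  initial : ∀ᵐ ω ∂P, X 0 ω = U.initial
  step : ∀ (n : ℕ) (i : Fin q) (S : Set (EuclideanSpace ℝ (Fin q))), MeasurableSet S →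
    P⟦{ω | I n ω = i ∧ X (n + 1) ω - X n ω ∈ S} | urnHistory X I n⟧ =ᵐ[P]
      fun ω => U.drawProb (X n ω) i *
        (U.replacement i : Measure (EuclideanSpace ℝ (Fin q))).real S

/-- Tenability: at every time, almost surely, no colour has a negative amount and the total
activity is positive. -/
def IsTenable {q : ℕ} {Ω : Type*} [MeasurableSpace Ω] (U : PolyaUrn q)
    (P : Measure Ω) (X : ℕ → Ω → EuclideanSpace ℝ (Fin q)) : Prop :=
  ∀ n, ∀ᵐ ω ∂P, (∀ i, 0 ≤ X n ω i) ∧ 0 < U.weight (X n ω)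

/-- For an eigenvalue `μ` of `A`, the integer `ν` such that the nilpotent map `N` induced by
`A - μ` on the generalized eigenspace of `μ` satisfies `N ^ (ν + 1) = 0` and `N ^ ν ≠ 0`; so
`ν + 1` is the size of the largest Jordan block of `A` with eigenvalue `μ`. -/
def jordanNu {q : ℕ} (A : Matrix (Fin q) (Fin q) ℂ) (μ : ℂ) : ℕ :=
  sInf {k : ℕ | ∀ v ∈ Module.End.maxGenEigenspace (Matrix.toLin' A) μ,
    ((A - Matrix.scalar (Fin q) μ) ^ (k + 1)).mulVec v = 0}

/-- `lam` lists the eigenvalues of `A`, repeated according to algebraic multiplicity, with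
decreasing real parts and, among equal real parts, with decreasing `jordanNu`. -/
structure IsOrderedEigenvalues {q : ℕ} (A : Matrix (Fin q) (Fin q) ℂ) (lam : Fin q → ℂ) :
    Prop where
  roots : Finset.univ.val.map lam = A.charpoly.roots
  re_anti : ∀ i j, i ≤ j → (lam j).re ≤ (lam i).re
  nu_anti : ∀ i j, i ≤ j → (lam j).re = (lam i).re → jordanNu A (lam j) ≤ jordanNu A (lam i)

/-- `Z n` is the random vector `c n • (X n - 𝔼 (X n))`. -/
def centredScaled {q : ℕ} {Ω : Type*} [MeasurableSpace Ω] (P : Measure Ω)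
    (X : ℕ → Ω → EuclideanSpace ℝ (Fin q)) (c : ℕ → ℝ) (n : ℕ) (ω : Ω) :
    EuclideanSpace ℝ (Fin q) :=
  c n • (X n ω - ∫ ω', X n ω' ∂P)

/-- All moments of order at most `p` of the random vectors `Z n` are finite and converge to the
corresponding moments of the law `ν`: the mixed moments, the absolute moments of the Euclidean
norm, and the mixed absolute moments. -/
structure MomentsConverge {q : ℕ} {Ω : Type*} [MeasurableSpace Ω] (P : Measure Ω)
    (Z : ℕ → Ω → EuclideanSpace ℝ (Fin q)) (ν : Measure (EuclideanSpace ℝ (Fin q))) (p : ℝ) :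
    Prop where
  memLp : ∀ n, MemLp (Z n) (ENNReal.ofReal p) P
  memLp_limit : MemLp id (ENNReal.ofReal p) ν
  mixed : ∀ k : Fin q → ℕ, ((∑ i, k i : ℕ) : ℝ) ≤ p →
    Tendsto (fun n => ∫ ω, ∏ i, Z n ω i ^ k i ∂P) atTop (𝓝 (∫ x, ∏ i, x i ^ k i ∂ν))
  norm : ∀ r : ℝ, 0 < r → r ≤ p →
    Tendsto (fun n => ∫ ω, ‖Z n ω‖ ^ r ∂P) atTop (𝓝 (∫ x, ‖x‖ ^ r ∂ν))
  mixed_abs : ∀ r : Fin q → ℝ, (∀ i, 0 ≤ r i) → ∑ i, r i ≤ p →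
    Tendsto (fun n => ∫ ω, ∏ i, |Z n ω i| ^ r i ∂P) atTop (𝓝 (∫ x, ∏ i, |x i| ^ r i ∂ν))

end

/-! By balance the total activity at time `k` is the nonrandom number `w_k = w_0 + k b`. With `A`
the intensity matrix and `Y_k` the centred increments, this gives the linear recursion `X_{k+1} = (1
+ A / w_k) X_k + Y_k`. Solving it, `X_n - E X_n` is the sum over `k < n` of `F_{k+1,n} Y_k`, where
`F_{k+1,n}` is the product of the later factors `1 + A / w_j` (`ae_deviation_eq_sum`). Each
coordinate is thus a finite sum of martingale transforms with deterministic coefficients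
(`ae_deviation_apply`).

Size of the coefficients: balance makes the activity vector `a` a left eigenvector of `A` for `b`,
and also forces `a · Y_k = 0`. Since `Re λ₂ < b`, the eigenvalue `b` is simple, so the kernel of `a`
is contained in the sum of the other generalized eigenspaces. On it `F_{k+1,n}` grows roughly at
most like `(n/k)^(σ/b)` for some `σ < b/2` in case (i), and like `(n/k)^(1/2) (1 + log (n/k))^ν₂` in
case (ii). Summing squares over `k` gives `O(n)` and `O(n (log n)^(2 ν₂ + 1))`: after normalization
the coefficients are bounded in `ℓ²` uniformly in `n` (`PolyaUrn.sum_coef_sq_le`).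

Uniform integrability: a martingale transform with coefficients bounded in `ℓ²` has `r`-th absolute
moment at most a constant times the `r`-th absolute moments of the replacements, for every `r ≥ 2`
(`integral_abs_innovSum_rpow_le`). For `r = p` this only bounds the `p`-th moments. Splitting each
replacement coordinate into a bounded part, controlled in `L^(p+1)`, and a part with small `p`-th
moment makes the tails of `‖Z_n‖^p` uniformly small (`integrable_centredScaled_and_tail`). Together
with the assumed convergence in distribution this yields convergence of the means of all continuous
functions dominated by `1 + ‖x‖^p` (`tendsto_integral_of_tendstoInDistribution`). -/

noncomputable section


/-! ### Conditional laws of the increments -/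

namespace PolyaUrn

variable {q : ℕ}

/-- The mean of `f (ξ i)`, for a colour `i` drawn from an urn with composition `x`. -/
def meanRepl (U : PolyaUrn q) (f : EuclideanSpace ℝ (Fin q) → ℝ)
    (x : EuclideanSpace ℝ (Fin q)) : ℝ :=
  ∑ i, U.drawProb x i * ∫ y, f y ∂(U.replacement i : Measure (EuclideanSpace ℝ (Fin q)))

/-- The centred increment `f (X (n + 1) - X n) - 𝔼[f (X (n + 1) - X n) | past]`. -/
def innov {Ω : Type*} (U : PolyaUrn q) (X : ℕ → Ω → EuclideanSpace ℝ (Fin q))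
    (f : EuclideanSpace ℝ (Fin q) → ℝ) (n : ℕ) (ω : Ω) : ℝ :=
  f (X (n + 1) ω - X n ω) - U.meanRepl f (X n ω)

lemma continuous_weight (U : PolyaUrn q) : Continuous U.weight := by
  unfold weight; fun_prop

lemma measurable_drawProb (U : PolyaUrn q) (i : Fin q) :
    Measurable fun x => U.drawProb x i := by
  have := U.continuous_weight.measurable
  unfold drawProb; fun_prop

lemma measurable_meanRepl (U : PolyaUrn q) (f : EuclideanSpace ℝ (Fin q) → ℝ) :
    Measurable (U.meanRepl f) := by
  have := U.measurable_drawProb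
  unfold meanRepl; fun_prop

lemma drawProb_nonneg (U : PolyaUrn q) {x : EuclideanSpace ℝ (Fin q)} (hx : ∀ i, 0 ≤ x i)
    (hw : 0 < U.weight x) (i : Fin q) : 0 ≤ U.drawProb x i :=
  div_nonneg (mul_nonneg (U.activity_nonneg i) (hx i)) hw.le

lemma sum_drawProb (U : PolyaUrn q) {x : EuclideanSpace ℝ (Fin q)}
    (hw : 0 < U.weight x) : ∑ i, U.drawProb x i = 1 := by
  simp only [drawProb, ← Finset.sum_div]
  exact div_self hw.ne'

lemma drawProb_le_one (U : PolyaUrn q) {x : EuclideanSpace ℝ (Fin q)} (hx : ∀ i, 0 ≤ x i)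
    (hw : 0 < U.weight x) (i : Fin q) : U.drawProb x i ≤ 1 := by
  rw [← U.sum_drawProb hw]
  exact Finset.single_le_sum (fun j _ => U.drawProb_nonneg hx hw j) (Finset.mem_univ i)

end PolyaUrn

set_option linter.unusedSectionVars false

section Urn

variable {q : ℕ} {U : PolyaUrn q} {Ω : Type*} [mΩ : MeasurableSpace Ω] {P : Measure Ω}
  [IsProbabilityMeasure P] {X : ℕ → Ω → EuclideanSpace ℝ (Fin q)} {I : ℕ → Ω → Fin q}

lemma urnHistory_le (hX : IsPolyaUrnProcess U P X I) (n : ℕ) : urnHistory X I n ≤ mΩ := by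
  refine sup_le (iSup₂_le fun k _ => ?_) (iSup₂_le fun k _ => ?_)
  · exact (hX.measurable_composition k).comap_le
  · exact (hX.measurable_draw k).comap_le

lemma measurable_urnHistory {k n : ℕ} (hk : k ≤ n) : Measurable[urnHistory X I n] (X k) := by
  apply measurable_iff_comap_le.2
  exact le_sup_of_le_left (le_iSup₂_of_le k hk le_rfl)

lemma measurable_increment (hX : IsPolyaUrnProcess U P X I) (n : ℕ) :
    Measurable fun ω => X (n + 1) ω - X n ω :=
  (hX.measurable_composition _).sub (hX.measurable_composition _)

lemma integrable_drawProb (hX : IsPolyaUrnProcess U P X I) (hten : IsTenable U P X) (n : ℕ)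
    (i : Fin q) : Integrable (fun ω => U.drawProb (X n ω) i) P := by
  refine Integrable.of_bound (C := 1)
    (((U.measurable_drawProb i).comp (hX.measurable_composition n)).aestronglyMeasurable) ?_
  filter_upwards [hten n] with ω hω
  rw [Real.norm_eq_abs, abs_of_nonneg (U.drawProb_nonneg hω.1 hω.2 i)]
  exact U.drawProb_le_one hω.1 hω.2 i

/-- Split by the colour drawn and integrate the conditional law over the past event `B`. This turns
the set-wise hypothesis `step` into an identity of measures that can be integrated against any `f`.
-/
lemma map_increment_restrict (hX : IsPolyaUrnProcess U P X I) (hten : IsTenable U P X) (n : ℕ)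
    {B : Set Ω} (hB : MeasurableSet[urnHistory X I n] B) :
    (P.restrict B).map (fun ω => X (n + 1) ω - X n ω) =
      ∑ i, ENNReal.ofReal (∫ ω in B, U.drawProb (X n ω) i ∂P) •
        (U.replacement i : Measure (EuclideanSpace ℝ (Fin q))) := by
  have hle := urnHistory_le hX n
  have hinc := measurable_increment hX n
  ext T hT
  have hcell : ∀ i, P ({ω | I n ω = i ∧ X (n + 1) ω - X n ω ∈ T} ∩ B) =
      ENNReal.ofReal (∫ ω in B, U.drawProb (X n ω) i ∂P) *
        (U.replacement i : Measure (EuclideanSpace ℝ (Fin q))) T := by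
    intro i
    have hm : MeasurableSet {ω | I n ω = i ∧ X (n + 1) ω - X n ω ∈ T} :=
      (hX.measurable_draw n (measurableSet_singleton i)).inter (hinc hT)
    have hc : 0 ≤ ∫ ω in B, U.drawProb (X n ω) i ∂P := by
      refine integral_nonneg_of_ae (ae_restrict_of_ae ?_)
      filter_upwards [hten n] with ω hω using U.drawProb_nonneg hω.1 hω.2 i
    have h1 : ∫ ω in B, Set.indicator {ω | I n ω = i ∧ X (n + 1) ω - X n ω ∈ T}
        (fun _ => (1 : ℝ)) ω ∂P =
        (∫ ω in B, U.drawProb (X n ω) i ∂P) *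
          (U.replacement i : Measure (EuclideanSpace ℝ (Fin q))).real T := by
      rw [← setIntegral_condExp hle ((integrable_const _).indicator hm) hB,
        ← integral_mul_const]
      exact integral_congr_ae (ae_restrict_of_ae (hX.step n i T hT))
    rw [integral_indicator hm, setIntegral_const, smul_eq_mul, mul_one,
      measureReal_restrict_apply hm] at h1
    rw [← ofReal_measureReal (by finiteness), h1, ENNReal.ofReal_mul hc, ofReal_measureReal
      (by finiteness)]
  rw [Measure.map_apply hinc hT, Measure.restrict_apply (hinc hT), Measure.finsetSum_apply]
  simp only [Measure.smul_apply, smul_eq_mul, ← hcell]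
  rw [← measure_biUnion_finset]
  · congr 1
    ext ω
    simp
  · intro i _ j _ hij
    refine Set.disjoint_left.2 fun ω h h' => hij ?_
    exact h.1.1.symm.trans h'.1.1
  · intro i _
    exact ((hX.measurable_draw n (measurableSet_singleton i)).inter (hinc hT)).inter (hle _ hB)

/-- The mixture weights are at most 1. The dominating measure does not depend on `n`, so null sets,
integrability and moment bounds pass from the replacements to all increments uniformly. -/
lemma map_increment_le (hX : IsPolyaUrnProcess U P X I) (hten : IsTenable U P X) (n : ℕ) :
    P.map (fun ω => X (n + 1) ω - X n ω) ≤
      ∑ i, (U.replacement i : Measure (EuclideanSpace ℝ (Fin q))) := by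
  have h := map_increment_restrict hX hten n MeasurableSet.univ
  rw [Measure.restrict_univ] at h
  rw [h]
  refine Finset.sum_le_sum fun i _ => ?_
  intro T
  rw [Measure.smul_apply, smul_eq_mul]
  refine mul_le_of_le_one_left (zero_le) ?_
  rw [ENNReal.ofReal_le_one]
  calc ∫ ω, U.drawProb (X n ω) i ∂P ≤ ∫ ω, (1 : ℝ) ∂P := by
        refine integral_mono_ae (integrable_drawProb hX hten n i) (integrable_const _) ?_
        filter_upwards [hten n] with ω hω using U.drawProb_le_one hω.1 hω.2 i
    _ = 1 := by simp

lemma ae_increment (hX : IsPolyaUrnProcess U P X I) (hten : IsTenable U P X) (n : ℕ)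
    {p : EuclideanSpace ℝ (Fin q) → Prop}
    (hp : ∀ i, ∀ᵐ x ∂(U.replacement i : Measure (EuclideanSpace ℝ (Fin q))), p x) :
    ∀ᵐ ω ∂P, p (X (n + 1) ω - X n ω) := by
  refine ae_of_ae_map (measurable_increment hX n).aemeasurable ?_
  refine (Measure.absolutelyContinuous_of_le (map_increment_le hX hten n)).ae_le ?_
  change ∀ᵐ x ∂(∑ i, (U.replacement i : Measure (EuclideanSpace ℝ (Fin q)))), p x
  rw [ae_iff, Measure.finsetSum_apply]
  exact Finset.sum_eq_zero fun i _ => ae_iff.1 (hp i)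

lemma integrable_comp_increment (hX : IsPolyaUrnProcess U P X I) (hten : IsTenable U P X) (n : ℕ)
    {f : EuclideanSpace ℝ (Fin q) → ℝ}
    (hf : ∀ i, Integrable f (U.replacement i : Measure (EuclideanSpace ℝ (Fin q)))) :
    Integrable (fun ω => f (X (n + 1) ω - X n ω)) P := by
  have h : Integrable f (P.map (fun ω => X (n + 1) ω - X n ω)) :=
    (integrable_finsetSum_measure.2 fun i _ => hf i).mono_measure (map_increment_le hX hten n)
  exact h.comp_measurable (measurable_increment hX n)

lemma integral_comp_increment_le (hX : IsPolyaUrnProcess U P X I) (hten : IsTenable U P X) (n : ℕ)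
    {f : EuclideanSpace ℝ (Fin q) → ℝ} (hf0 : ∀ x, 0 ≤ f x)
    (hf : ∀ i, Integrable f (U.replacement i : Measure (EuclideanSpace ℝ (Fin q)))) :
    ∫ ω, f (X (n + 1) ω - X n ω) ∂P ≤
      ∑ i, ∫ x, f x ∂(U.replacement i : Measure (EuclideanSpace ℝ (Fin q))) := by
  have hs : Integrable f (∑ i, (U.replacement i : Measure (EuclideanSpace ℝ (Fin q)))) :=
    integrable_finsetSum_measure.2 fun i _ => hf i
  have h := hs.mono_measure (map_increment_le hX hten n)
  rw [← integral_finsetSum_measure fun i _ => hf i,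
    ← integral_map (measurable_increment hX n).aemeasurable h.aestronglyMeasurable]
  exact integral_mono_measure (map_increment_le hX hten n) (ae_of_all _ hf0) hs

lemma integrable_meanRepl (hX : IsPolyaUrnProcess U P X I) (hten : IsTenable U P X) (n : ℕ)
    (f : EuclideanSpace ℝ (Fin q) → ℝ) : Integrable (fun ω => U.meanRepl f (X n ω)) P :=
  integrable_finsetSum _ fun i _ => (integrable_drawProb hX hten n i).mul_const _

lemma integrable_innov (hX : IsPolyaUrnProcess U P X I) (hten : IsTenable U P X) (n : ℕ)
    {f : EuclideanSpace ℝ (Fin q) → ℝ}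
    (hf : ∀ i, Integrable f (U.replacement i : Measure (EuclideanSpace ℝ (Fin q)))) :
    Integrable (U.innov X f n) P :=
  (integrable_comp_increment hX hten n hf).sub (integrable_meanRepl hX hten n f)

lemma condExp_comp_increment (hX : IsPolyaUrnProcess U P X I) (hten : IsTenable U P X) (n : ℕ)
    {f : EuclideanSpace ℝ (Fin q) → ℝ}
    (hf : ∀ i, Integrable f (U.replacement i : Measure (EuclideanSpace ℝ (Fin q)))) :
    (fun ω => U.meanRepl f (X n ω)) =ᵐ[P]
      P[fun ω => f (X (n + 1) ω - X n ω) | urnHistory X I n] := by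
  refine ae_eq_condExp_of_forall_setIntegral_eq (urnHistory_le hX n)
    (integrable_comp_increment hX hten n hf)
    (fun _ _ _ => (integrable_meanRepl hX hten n f).integrableOn) (fun B hB _ => ?_)
    ((U.measurable_meanRepl f).comp
      (measurable_urnHistory le_rfl)).stronglyMeasurable.aestronglyMeasurable
  have hmap := map_increment_restrict hX hten n hB
  have hfin : ∀ i ∈ Finset.univ, Integrable f
      (ENNReal.ofReal (∫ ω in B, U.drawProb (X n ω) i ∂P) •
        (U.replacement i : Measure (EuclideanSpace ℝ (Fin q)))) :=
    fun i _ => (hf i).smul_measure ENNReal.ofReal_ne_top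
  have hfm := integrable_finsetSum_measure.2 hfin
  rw [← hmap] at hfm
  rw [← integral_map (measurable_increment hX n).aemeasurable hfm.aestronglyMeasurable, hmap,
    integral_finsetSum_measure hfin]
  unfold PolyaUrn.meanRepl
  rw [integral_finsetSum _ fun i _ => ((integrable_drawProb hX hten n i).mul_const _).integrableOn]
  refine Finset.sum_congr rfl fun i _ => ?_
  rw [integral_smul_measure, integral_mul_const, ENNReal.toReal_ofReal, smul_eq_mul]
  refine integral_nonneg_of_ae (ae_restrict_of_ae ?_)
  filter_upwards [hten n] with ω hω using U.drawProb_nonneg hω.1 hω.2 i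

/-- The innovations are martingale differences: pull the past-measurable factor `h` out of the
conditional expectation. -/
lemma integral_mul_innov (hX : IsPolyaUrnProcess U P X I) (hten : IsTenable U P X) (n : ℕ)
    {f : EuclideanSpace ℝ (Fin q) → ℝ}
    (hf : ∀ i, Integrable f (U.replacement i : Measure (EuclideanSpace ℝ (Fin q))))
    {h : Ω → ℝ} (hm : Measurable[urnHistory X I n] h)
    (hi : Integrable (fun ω => h ω * U.innov X f n ω) P) :
    ∫ ω, h ω * U.innov X f n ω ∂P = 0 := by
  have hle := urnHistory_le hX n
  have hz : P[U.innov X f n | urnHistory X I n] =ᵐ[P] 0 := by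
    have h1 := condExp_sub (integrable_comp_increment hX hten n hf)
      (integrable_meanRepl hX hten n f) (urnHistory X I n)
    have h2 := condExp_of_stronglyMeasurable hle ((U.measurable_meanRepl f).comp
      (measurable_urnHistory (X := X) (I := I) (le_refl n))).stronglyMeasurable
      (integrable_meanRepl hX hten n f)
    refine h1.trans ?_
    filter_upwards [condExp_comp_increment hX hten n hf] with ω h3
    have h4 := congrFun h2 ω
    simp only [Function.comp_def] at h4
    simp only [Pi.sub_apply, Pi.zero_apply, ← h3]
    rw [sub_eq_zero]
    exact h4.symm
  rw [← integral_condExp hle]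
  have h5 := condExp_mul_of_stronglyMeasurable_left hm.stronglyMeasurable hi
    (integrable_innov hX hten n hf)
  refine integral_eq_zero_of_ae (h5.trans ?_)
  filter_upwards [hz] with ω h6
  simp [h6]

end Urn


/-! ### Moment bounds for martingale transforms -/

/-- The linear term is kept exactly, since it will have mean zero. For `|r t| ≤ 1` use `1 + t ≤ exp
t` and the second-order bound on `exp`; otherwise `1 < r |t|`, and the `t ^ 2` and `|t| ^ r` terms
dominate everything. -/
lemma abs_one_add_rpow_le {r : ℝ} (hr : 2 ≤ r) (t : ℝ) :
    |1 + t| ^ r ≤ 1 + r * t + (r ^ 2 + (r + 1) ^ r) * (t ^ 2 + |t| ^ r) := by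
  have hr0 : 0 < r := by linarith
  have hP : 0 ≤ (r + 1) ^ r := by positivity
  have hQ : 0 ≤ |t| ^ r := by positivity
  have h1 : 0 ≤ r ^ 2 * |t| ^ r := by positivity
  have h2 : 0 ≤ (r + 1) ^ r * t ^ 2 := by positivity
  have h3 : 0 ≤ (r + 1) ^ r * |t| ^ r := by positivity
  rcases le_or_gt |r * t| 1 with h | h
  · have ht : 0 ≤ 1 + t := by
      rw [abs_mul, abs_of_pos hr0] at h
      have : |t| ≤ 1 := by nlinarith [abs_nonneg t]
      linarith [neg_abs_le t]
    have h4 : |1 + t| ^ r ≤ Real.exp (r * t) := by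
      rw [abs_of_nonneg ht, mul_comm, Real.exp_mul]
      exact Real.rpow_le_rpow ht (by linarith [Real.add_one_le_exp t]) hr0.le
    have h5 := (abs_le.1 (Real.abs_exp_sub_one_sub_id_le h)).2
    nlinarith
  · rw [abs_mul, abs_of_pos hr0] at h
    have h4 : |1 + t| ^ r ≤ (r + 1) ^ r * |t| ^ r := by
      rw [← Real.mul_rpow (by positivity) (abs_nonneg t)]
      refine Real.rpow_le_rpow (abs_nonneg _) ?_ hr0.le
      calc |1 + t| ≤ 1 + |t| := by simpa using abs_add_le 1 t
        _ ≤ (r + 1) * |t| := by linarith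
    have h5 : -(r * t) ≤ r ^ 2 * t ^ 2 := by
      have : r ^ 2 * t ^ 2 = (r * |t|) * (r * |t|) := by
        rw [← sq_abs t]; ring
      rw [this]
      nlinarith [neg_abs_le t]
    nlinarith

/-- The previous inequality scaled by `|x| ^ r`, with `t = d / x`. -/
lemma abs_add_rpow_le {r : ℝ} (hr : 2 ≤ r) (x d : ℝ) :
    |x + d| ^ r ≤ |x| ^ r + r * (|x| ^ (r - 2) * x * d) +
      (r ^ 2 + (r + 1) ^ r) * (|x| ^ (r - 2) * d ^ 2 + |d| ^ r) := by
  rcases eq_or_ne x 0 with rfl | hx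
  · have h1 : (1 : ℝ) ≤ r ^ 2 + (r + 1) ^ r := by
      have : 0 ≤ (r + 1) ^ r := by positivity
      nlinarith
    have h2 : 0 ≤ |d| ^ r := by positivity
    have h3 : (0 : ℝ) ≤ |0| ^ (r - 2) * d ^ 2 := by positivity
    have h4 : |(0 : ℝ)| ^ r = 0 := by rw [abs_zero, Real.zero_rpow (by linarith)]
    rw [h4]
    simp only [zero_add, mul_zero, zero_mul]
    nlinarith
  · have hx' : 0 < |x| := abs_pos.2 hx
    obtain ⟨t, rfl⟩ : ∃ t, d = x * t := ⟨d / x, by field_simp⟩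
    have h := abs_one_add_rpow_le hr t
    have hsp : |x| ^ r = |x| ^ (r - 2) * x ^ 2 := by
      rw [← sq_abs x, ← Real.rpow_natCast, ← Real.rpow_add hx']
      norm_num
    have e1 : |x + x * t| ^ r = |x| ^ r * |1 + t| ^ r := by
      rw [← Real.mul_rpow hx'.le (abs_nonneg _), ← abs_mul]; ring_nf
    have e2 : |x * t| ^ r = |x| ^ r * |t| ^ r := by
      rw [abs_mul, Real.mul_rpow hx'.le (abs_nonneg _)]
    have h' := mul_le_mul_of_nonneg_left h (by positivity : 0 ≤ |x| ^ r)
    rw [e1, e2]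
    refine h'.trans (le_of_eq ?_)
    rw [hsp]; ring

lemma rpow_mul_rpow_le_add {a b s t : ℝ} (ha : 0 ≤ a) (hb : 0 ≤ b) (hs : 0 ≤ s) (ht : 0 ≤ t) :
    a ^ s * b ^ t ≤ a ^ (s + t) + b ^ (s + t) := by
  rcases le_total a b with h | h
  · calc a ^ s * b ^ t ≤ b ^ s * b ^ t := by gcongr
      _ = b ^ (s + t) := (Real.rpow_add_of_nonneg hb hs ht).symm
      _ ≤ _ := le_add_of_nonneg_left (by positivity)
  · calc a ^ s * b ^ t ≤ a ^ s * a ^ t := by gcongr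
      _ = a ^ (s + t) := (Real.rpow_add_of_nonneg ha hs ht).symm
      _ ≤ _ := le_add_of_nonneg_right (by positivity)

lemma abs_add_rpow_le_two_rpow {r : ℝ} (hr : 0 ≤ r) (a b : ℝ) :
    |a + b| ^ r ≤ 2 ^ r * (|a| ^ r + |b| ^ r) := by
  have hm : |a + b| ≤ 2 * max |a| |b| := by
    linarith [abs_add_le a b, le_max_left |a| |b|, le_max_right |a| |b|]
  calc |a + b| ^ r ≤ (2 * max |a| |b|) ^ r := Real.rpow_le_rpow (abs_nonneg _) hm hr
    _ = 2 ^ r * (max |a| |b|) ^ r := Real.mul_rpow (by norm_num) (by positivity)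
    _ ≤ _ := by
      gcongr
      rcases max_choice |a| |b| with h | h <;> rw [h]
      · exact le_add_of_nonneg_right (by positivity)
      · exact le_add_of_nonneg_left (by positivity)

lemma abs_le_one_add_rpow {r : ℝ} (hr : 1 ≤ r) {a : ℝ} (ha : 0 ≤ a) : a ≤ 1 + a ^ r := by
  rcases le_total a 1 with h | h
  · linarith [Real.rpow_nonneg ha r]
  · linarith [Real.self_le_rpow_of_one_le h hr]

lemma integrable_of_integrable_abs_rpow {α : Type*} [MeasurableSpace α] {μ : Measure α}
    [IsFiniteMeasure μ] {r : ℝ} (hr : 1 ≤ r) {f : α → ℝ} (hf : AEStronglyMeasurable f μ)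
    (hi : Integrable (fun x => |f x| ^ r) μ) : Integrable f μ := by
  refine ((integrable_const (1 : ℝ)).add hi).mono' hf (ae_of_all _ fun x => ?_)
  exact abs_le_one_add_rpow hr (abs_nonneg (f x))

lemma abs_integral_rpow_le {α : Type*} [MeasurableSpace α] {μ : Measure α}
    [IsProbabilityMeasure μ] {r : ℝ} (hr : 1 ≤ r) {f : α → ℝ} (hf : AEStronglyMeasurable f μ)
    (hi : Integrable (fun x => |f x| ^ r) μ) : |∫ x, f x ∂μ| ^ r ≤ ∫ x, |f x| ^ r ∂μ := by
  refine (Real.rpow_le_rpow (abs_nonneg _) abs_integral_le_integral_abs (by linarith)).trans ?_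
  exact (convexOn_rpow hr).map_integral_le
    (continuousOn_id.rpow_const fun _ _ => Or.inr (by linarith)) isClosed_Ici
    (ae_of_all _ fun x => abs_nonneg (f x)) (integrable_of_integrable_abs_rpow hr hf hi).abs hi

/-- The sum over the colours `i` of the absolute moments `𝔼 |f (ξ i)| ^ r`. -/
def PolyaUrn.absMoment {q : ℕ} (U : PolyaUrn q) (f : EuclideanSpace ℝ (Fin q) → ℝ) (r : ℝ) : ℝ :=
  ∑ i, ∫ x, |f x| ^ r ∂(U.replacement i : Measure (EuclideanSpace ℝ (Fin q)))

lemma PolyaUrn.absMoment_nonneg {q : ℕ} (U : PolyaUrn q) (f : EuclideanSpace ℝ (Fin q) → ℝ)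
    (r : ℝ) : 0 ≤ U.absMoment f r :=
  Finset.sum_nonneg fun _ _ => integral_nonneg fun _ => by positivity

/-- Jensen twice: for the draw probabilities, then for each replacement law. -/
lemma PolyaUrn.abs_meanRepl_rpow_le {q : ℕ} (U : PolyaUrn q) {x : EuclideanSpace ℝ (Fin q)}
    (hx : ∀ i, 0 ≤ x i) (hw : 0 < U.weight x) {r : ℝ} (hr : 1 ≤ r)
    {f : EuclideanSpace ℝ (Fin q) → ℝ} (hf : Measurable f)
    (hi : ∀ i, Integrable (fun x => |f x| ^ r)
      (U.replacement i : Measure (EuclideanSpace ℝ (Fin q)))) :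
    |U.meanRepl f x| ^ r ≤ U.absMoment f r := by
  have h1 : |U.meanRepl f x| ≤ ∑ i, U.drawProb x i *
      |∫ y, f y ∂(U.replacement i : Measure (EuclideanSpace ℝ (Fin q)))| := by
    refine (Finset.abs_sum_le_sum_abs _ _).trans (Finset.sum_le_sum fun i _ => ?_)
    rw [abs_mul, abs_of_nonneg (U.drawProb_nonneg hx hw i)]
  calc |U.meanRepl f x| ^ r ≤ (∑ i, U.drawProb x i *
      |∫ y, f y ∂(U.replacement i : Measure (EuclideanSpace ℝ (Fin q)))|) ^ r :=
        Real.rpow_le_rpow (abs_nonneg _) h1 (by linarith)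
    _ ≤ ∑ i, U.drawProb x i *
      |∫ y, f y ∂(U.replacement i : Measure (EuclideanSpace ℝ (Fin q)))| ^ r :=
        Real.rpow_arith_mean_le_arith_mean_rpow _ _ _ (fun i _ => U.drawProb_nonneg hx hw i)
          (U.sum_drawProb hw) (fun i _ => abs_nonneg _) hr
    _ ≤ U.absMoment f r := by
        refine Finset.sum_le_sum fun i _ => ?_
        refine (mul_le_of_le_one_left (by positivity) (U.drawProb_le_one hx hw i)).trans ?_
        exact abs_integral_rpow_le hr hf.aestronglyMeasurable (hi i)

section Urn

variable {q : ℕ} {U : PolyaUrn q} {Ω : Type*} [mΩ : MeasurableSpace Ω] {P : Measure Ω}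
  [IsProbabilityMeasure P] {X : ℕ → Ω → EuclideanSpace ℝ (Fin q)} {I : ℕ → Ω → Fin q}

lemma measurable_innov {k n : ℕ} (hk : k < n) {f : EuclideanSpace ℝ (Fin q) → ℝ}
    (hf : Measurable f) : Measurable[urnHistory X I n] (U.innov X f k) := by
  have h1 : Measurable[urnHistory X I n] (X k) := measurable_urnHistory hk.le
  have h2 : Measurable[urnHistory X I n] (X (k + 1)) := measurable_urnHistory hk
  exact (hf.comp (h2.sub h1)).sub ((U.measurable_meanRepl f).comp h1)

lemma integrable_abs_innov_rpow (hX : IsPolyaUrnProcess U P X I) (hten : IsTenable U P X) {r : ℝ}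
    (hr : 1 ≤ r) {f : EuclideanSpace ℝ (Fin q) → ℝ} (hf : Measurable f)
    (hi : ∀ i, Integrable (fun x => |f x| ^ r)
      (U.replacement i : Measure (EuclideanSpace ℝ (Fin q)))) (n : ℕ) :
    Integrable (fun ω => |U.innov X f n ω| ^ r) P ∧
      ∫ ω, |U.innov X f n ω| ^ r ∂P ≤ 2 ^ r * 2 * U.absMoment f r := by
  have hb : ∀ᵐ ω ∂P, |U.innov X f n ω| ^ r ≤
      2 ^ r * (|f (X (n + 1) ω - X n ω)| ^ r + U.absMoment f r) := by
    filter_upwards [hten n] with ω hω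
    have h1 := abs_add_rpow_le_two_rpow (by linarith : 0 ≤ r) (f (X (n + 1) ω - X n ω))
      (-(U.meanRepl f (X n ω)))
    rw [← sub_eq_add_neg, abs_neg] at h1
    refine h1.trans ?_
    gcongr
    exact U.abs_meanRepl_rpow_le hω.1 hω.2 hr hf hi
  have hint : Integrable (fun ω => 2 ^ r * (|f (X (n + 1) ω - X n ω)| ^ r + U.absMoment f r)) P :=
    ((integrable_comp_increment hX hten n hi).add (integrable_const _)).const_mul _
  have hm : Measurable (U.innov X f n) :=
    (measurable_innov (I := I) (Nat.lt_succ_self n) hf).mono (urnHistory_le hX _) le_rfl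
  have hI : Integrable (fun ω => |U.innov X f n ω| ^ r) P := by
    refine hint.mono' (by fun_prop (disch := linarith)) ?_
    filter_upwards [hb] with ω h
    rwa [Real.norm_of_nonneg (by positivity)]
  refine ⟨hI, (integral_mono_ae hI hint hb).trans ?_⟩
  rw [integral_const_mul, integral_add (integrable_comp_increment hX hten n hi)
    (integrable_const _)]
  have := integral_comp_increment_le hX hten n (f := fun x => |f x| ^ r)
    (fun _ => by positivity) hi
  simp only [integral_const, probReal_univ, one_smul]
  rw [mul_assoc]
  gcongr
  rw [two_mul]
  gcongr
  exact this

/-- The martingale transform with coefficients `c` of the centred increments of `f`. -/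
def innovSum (U : PolyaUrn q) (X : ℕ → Ω → EuclideanSpace ℝ (Fin q))
    (f : EuclideanSpace ℝ (Fin q) → ℝ) (c : ℕ → ℝ) (n : ℕ) (ω : Ω) : ℝ :=
  ∑ k ∈ Finset.range n, c k * U.innov X f k ω

lemma measurable_innovSum (n : ℕ) {f : EuclideanSpace ℝ (Fin q) → ℝ}
    (hf : Measurable f) (c : ℕ → ℝ) : Measurable[urnHistory X I n] (innovSum U X f c n) :=
  Finset.measurable_fun_sum _ fun k hk =>
    (measurable_innov (Finset.mem_range.1 hk) hf).const_mul (c k)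

/-- Expand with `abs_add_rpow_le`: the linear term integrates to zero, and the rest carries a factor
`c n ^ 2`, since `|c n| ^ r ≤ κ * c n ^ 2`. The mixed term is split by `rpow_mul_rpow_le_add`. -/
lemma integral_abs_innovSum_rpow_step (hX : IsPolyaUrnProcess U P X I) (hten : IsTenable U P X)
    {r : ℝ} (hr : 2 ≤ r) {f : EuclideanSpace ℝ (Fin q) → ℝ} (hf : Measurable f)
    (hi : ∀ i, Integrable (fun x => |f x| ^ r)
      (U.replacement i : Measure (EuclideanSpace ℝ (Fin q)))) (c : ℕ → ℝ) (n : ℕ) {κ : ℝ}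
    (hκ : |c n| ^ (r - 2) ≤ κ)
    (hS : Integrable (fun ω => |innovSum U X f c n ω| ^ r) P) :
    Integrable (fun ω => |innovSum U X f c (n + 1) ω| ^ r) P ∧
      ∫ ω, |innovSum U X f c (n + 1) ω| ^ r ∂P ≤
        (1 + (r ^ 2 + (r + 1) ^ r) * c n ^ 2) * ∫ ω, |innovSum U X f c n ω| ^ r ∂P +
        (r ^ 2 + (r + 1) ^ r) * c n ^ 2 * ((1 + κ) * ∫ ω, |U.innov X f n ω| ^ r ∂P) := by
  have hr0 : 0 < r := by linarith
  set C := r ^ 2 + (r + 1) ^ r with hC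
  have hC0 : 0 ≤ C := by positivity
  set S := innovSum U X f c n with hSdef
  set Y := U.innov X f n with hYdef
  have hsucc : ∀ ω, innovSum U X f c (n + 1) ω = S ω + c n * Y ω := fun ω => by
    simp [innovSum, Finset.sum_range_succ, hSdef, hYdef]
  have hmS : Measurable[urnHistory X I n] S := measurable_innovSum n hf c
  have hmS' : Measurable S := hmS.mono (urnHistory_le hX n) le_rfl
  have hmY : Measurable Y :=
    (measurable_innov (I := I) (Nat.lt_succ_self n) hf).mono (urnHistory_le hX _) le_rfl
  have hY := (integrable_abs_innov_rpow hX hten (by linarith : 1 ≤ r) hf hi n).1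
  have hcross_m : Measurable[urnHistory X I n] (fun ω => |S ω| ^ (r - 2) * S ω) :=
    (((measurable_norm (α := ℝ)).comp hmS).pow_const (r - 2)).mul hmS
  have hcross : Integrable (fun ω => |S ω| ^ (r - 2) * S ω * Y ω) P := by
    refine (hS.add hY).mono' (by fun_prop) (ae_of_all _ fun ω => ?_)
    have h1 := rpow_mul_rpow_le_add (abs_nonneg (S ω)) (abs_nonneg (Y ω))
      (by linarith : 0 ≤ r - 1) zero_le_one
    rw [sub_add_cancel, Real.rpow_one] at h1
    have h2 : |S ω| ^ (r - 1) = |S ω| ^ (r - 2) * |S ω| := by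
      conv_rhs => rw [← Real.rpow_one |S ω|]
      rw [← Real.rpow_mul (abs_nonneg _), one_mul,
        ← Real.rpow_add_of_nonneg (abs_nonneg _) (by linarith) zero_le_one]
      congr 1; ring
    rw [Real.norm_eq_abs, abs_mul, abs_mul, abs_of_nonneg (by positivity : 0 ≤ |S ω| ^ (r - 2)),
      ← h2]
    exact h1
  have hzero := integral_mul_innov hX hten n
    (fun i =>
      integrable_of_integrable_abs_rpow (by linarith : 1 ≤ r) hf.aestronglyMeasurable (hi i))
    hcross_m hcross
  have hbound : ∀ ω, |innovSum U X f c (n + 1) ω| ^ r ≤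
      (1 + C * c n ^ 2) * |S ω| ^ r + r * c n * (|S ω| ^ (r - 2) * S ω * Y ω) +
        C * c n ^ 2 * ((1 + κ) * |Y ω| ^ r) := by
    intro ω
    rw [hsucc]
    refine (abs_add_rpow_le hr _ _).trans ?_
    rw [← hC]
    have h1 := rpow_mul_rpow_le_add (abs_nonneg (S ω)) (abs_nonneg (Y ω))
      (by linarith : 0 ≤ r - 2) zero_le_two
    rw [sub_add_cancel, Real.rpow_two, sq_abs] at h1
    have h2 : |c n * Y ω| ^ r ≤ c n ^ 2 * κ * |Y ω| ^ r := by
      rw [abs_mul, Real.mul_rpow (abs_nonneg _) (abs_nonneg _)]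
      gcongr
      calc |c n| ^ r = |c n| ^ (2 : ℝ) * |c n| ^ (r - 2) := by
            rw [← Real.rpow_add_of_nonneg (abs_nonneg _) zero_le_two (by linarith)]
            congr 1; ring
        _ ≤ c n ^ 2 * κ := by
            rw [Real.rpow_two, sq_abs]; gcongr
    have h3 := mul_le_mul_of_nonneg_left h1 (by positivity : 0 ≤ C * c n ^ 2)
    have h4 := mul_le_mul_of_nonneg_left h2 hC0
    nlinarith
  have hint := ((hS.const_mul (1 + C * c n ^ 2)).add (hcross.const_mul (r * c n))).add
    ((hY.const_mul (1 + κ)).const_mul (C * c n ^ 2))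
  have hI : Integrable (fun ω => |innovSum U X f c (n + 1) ω| ^ r) P := by
    refine hint.mono' ?_ (ae_of_all _ fun ω => ?_)
    · simp_rw [hsucc]; fun_prop (disch := linarith)
    · rw [Real.norm_of_nonneg (by positivity)]
      exact hbound ω
  refine ⟨hI, (integral_mono hI hint hbound).trans (le_of_eq ?_)⟩
  rw [integral_add' ((hS.const_mul _).add (hcross.const_mul _)) ((hY.const_mul _).const_mul _),
    integral_add' (hS.const_mul _) (hcross.const_mul _)]
  simp only [integral_const_mul]
  rw [hzero]; ring

/-- A martingale transform with square summable coefficients is bounded in `L^r`, `r ≥ 2`. -/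
lemma integral_abs_innovSum_rpow_le (hX : IsPolyaUrnProcess U P X I) (hten : IsTenable U P X)
    {r : ℝ} (hr : 2 ≤ r) (L : ℝ) : ∃ K, 0 ≤ K ∧ ∀ (f : EuclideanSpace ℝ (Fin q) → ℝ),
    Measurable f → (∀ i, Integrable (fun x => |f x| ^ r)
      (U.replacement i : Measure (EuclideanSpace ℝ (Fin q)))) → ∀ (c : ℕ → ℝ) (n : ℕ),
    ∑ k ∈ Finset.range n, c k ^ 2 ≤ L →
    Integrable (fun ω => |innovSum U X f c n ω| ^ r) P ∧
      ∫ ω, |innovSum U X f c n ω| ^ r ∂P ≤ K * U.absMoment f r := by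
  set C := r ^ 2 + (r + 1) ^ r with hC
  have hC0 : 0 ≤ C := by positivity
  -- Each single `c m ^ 2` is at most `L`, hence `|c m| ≤ 1 + |L|`. The resulting constant does not
  -- depend on `f`, which lets small moments of `f` give small moments of the transform.
  set κ := (1 + |L|) ^ (r - 2) with hκ
  have hκ0 : 0 ≤ κ := by positivity
  refine ⟨(1 + κ) * (2 ^ r * 2) * Real.exp (C * L), by positivity, fun f hf hi c n hL => ?_⟩
  set B := (1 + κ) * (2 ^ r * 2 * U.absMoment f r) with hB
  have hB0 : 0 ≤ B := by have := U.absMoment_nonneg f r; positivity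
  -- Discrete Grönwall; the `- 1` makes the bound vanish at `m = 0` and absorbs the inhomogeneous
  -- term at each step.
  have key : ∀ m ≤ n, Integrable (fun ω => |innovSum U X f c m ω| ^ r) P ∧
      ∫ ω, |innovSum U X f c m ω| ^ r ∂P ≤
        B * (Real.exp (C * ∑ k ∈ Finset.range m, c k ^ 2) - 1) := by
    intro m
    induction m with
    | zero =>
      intro _
      have : r ≠ 0 := by linarith
      simp [innovSum, Real.zero_rpow this]
    | succ m ih =>
      intro hm
      obtain ⟨h1, h2⟩ := ih (by omega)
      have hck : |c m| ^ (r - 2) ≤ κ := by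
        refine Real.rpow_le_rpow (abs_nonneg _) ?_ (by linarith)
        have h3 : c m ^ 2 ≤ L := le_trans (Finset.single_le_sum
          (f := fun k => c k ^ 2) (fun k _ => sq_nonneg _) (Finset.mem_range.2 (by omega))) hL
        have := sq_abs (c m)
        nlinarith [le_abs_self L, abs_nonneg (c m)]
      obtain ⟨h3, h4⟩ := integral_abs_innovSum_rpow_step hX hten hr hf hi c m hck h1
      refine ⟨h3, h4.trans ?_⟩
      rw [← hC, Finset.sum_range_succ, mul_add, Real.exp_add]
      have h5 := (integrable_abs_innov_rpow hX hten (by linarith : 1 ≤ r) hf hi m).2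
      have h6 : (1 + κ) * ∫ ω, |U.innov X f m ω| ^ r ∂P ≤ B := by rw [hB]; gcongr
      have hx : 0 ≤ C * c m ^ 2 := by positivity
      have h7 := Real.add_one_le_exp (C * c m ^ 2)
      set E := Real.exp (C * ∑ k ∈ Finset.range m, c k ^ 2)
      have hE : 0 ≤ E := by positivity
      calc _ ≤ (1 + C * c m ^ 2) * (B * (E - 1)) + C * c m ^ 2 * B := by gcongr
        _ = B * (E * (C * c m ^ 2 + 1) - 1) := by ring
        _ ≤ _ := by gcongr
  obtain ⟨h1, h2⟩ := key n le_rfl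
  refine ⟨h1, h2.trans ?_⟩
  have : Real.exp (C * ∑ k ∈ Finset.range n, c k ^ 2) ≤ Real.exp (C * L) := by gcongr
  calc _ ≤ B * Real.exp (C * L) := by gcongr; linarith
    _ = _ := by rw [hB]; ring

end Urn


/-! ### Products of the matrices `1 + t j • A` -/

/-- The product `(1 + t (k + m - 1) • A) * ⋯ * (1 + t k • A)`. -/
def propagator {q : ℕ} {R : Type*} [CommRing R] (A : Matrix (Fin q) (Fin q) R) (t : ℕ → R)
    (k : ℕ) : ℕ → Matrix (Fin q) (Fin q) R
  | 0 => 1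
  | m + 1 => (1 + t (k + m) • A) * propagator A t k m

lemma propagator_map {q : ℕ} {R S : Type*} [CommRing R] [CommRing S] (φ : R →+* S)
    (A : Matrix (Fin q) (Fin q) R) (t : ℕ → R) (k m : ℕ) :
    (propagator A t k m).map φ = propagator (A.map φ) (φ ∘ t) k m := by
  induction m with
  | zero => simp [propagator]
  | succ m ih =>
    have h : ((1 : Matrix (Fin q) (Fin q) R) + t (k + m) • A).map φ =
        1 + (φ ∘ t) (k + m) • A.map φ := by
      ext i j
      simp [Matrix.one_apply, apply_ite φ]
    rw [propagator, propagator, Matrix.map_mul, ih, h]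

lemma propagator_commute {q : ℕ} {R : Type*} [CommRing R] {A N : Matrix (Fin q) (Fin q) R}
    (h : Commute A N) (t : ℕ → R) (k m : ℕ) : Commute (propagator A t k m) N := by
  induction m with
  | zero => exact Commute.one_left N
  | succ m ih => exact (((Commute.one_left N).add_left (h.smul_left _)).mul_left ih)

lemma norm_one_add_ofReal_mul_le (μ : ℂ) (t : ℝ) :
    ‖1 + (t : ℂ) * μ‖ ≤ Real.exp (μ.re * t + ‖μ‖ ^ 2 / 2 * t ^ 2) := by
  refine abs_le_of_sq_le_sq' ?_ (Real.exp_nonneg _) |>.2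
  rw [← Real.exp_nat_mul]
  have h : ‖1 + (t : ℂ) * μ‖ ^ 2 = 1 + 2 * (μ.re * t) + ‖μ‖ ^ 2 * t ^ 2 := by
    rw [← Complex.normSq_eq_norm_sq, ← Complex.normSq_eq_norm_sq, Complex.normSq_apply,
      Complex.normSq_apply]
    simp
    ring
  rw [h]
  refine le_trans (le_of_eq ?_) (Real.add_one_le_exp _)
  push_cast
  ring

/-- The partial sums `t k + ⋯ + t (k + m - 1)`. -/
def stepSum (t : ℕ → ℝ) (k m : ℕ) : ℝ := ∑ j ∈ Finset.range m, t (k + j)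

lemma stepSum_nonneg {t : ℕ → ℝ} (ht : ∀ j, 0 ≤ t j) (k m : ℕ) : 0 ≤ stepSum t k m :=
  Finset.sum_nonneg fun _ _ => ht _

/-! ### Growth of propagators along generalized eigenvectors. -/

section Growth

variable {q : ℕ} {A : Matrix (Fin q) (Fin q) ℂ} {t : ℕ → ℝ}

/-- Write `A = μ + N`. As `N` commutes with the propagator, the new factor multiplies by `1 + t μ`
and adds `t` times the propagator applied to `N v`, which is one step lower in the Jordan chain. -/
lemma norm_propagator_succ_le (ht : ∀ j, 0 ≤ t j) (μ : ℂ) (v : Fin q → ℂ) (k m : ℕ) :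
    ‖(propagator A (fun j => (t j : ℂ)) k (m + 1)).mulVec v‖ ≤
      Real.exp (μ.re * t (k + m) + ‖μ‖ ^ 2 / 2 * t (k + m) ^ 2) *
        ‖(propagator A (fun j => (t j : ℂ)) k m).mulVec v‖ +
      t (k + m) * ‖(propagator A (fun j => (t j : ℂ)) k m).mulVec
        ((A - Matrix.scalar (Fin q) μ).mulVec v)‖ := by
  set N := A - Matrix.scalar (Fin q) μ with hN
  have hAN : Commute A N := by
    rw [hN]
    exact (Commute.refl A).sub_right (Matrix.scalar_commute μ (Commute.all μ) A).symm
  have hc := propagator_commute hAN (fun j => (t j : ℂ)) k m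
  set F := propagator A (fun j => (t j : ℂ)) k m
  have hA : A = Matrix.scalar (Fin q) μ + N := by rw [hN]; abel
  have hsc : ∀ x : Fin q → ℂ, (Matrix.scalar (Fin q) μ).mulVec x = μ • x := by
    intro x; ext i; simp [Matrix.mulVec_diagonal]
  have heq : (propagator A (fun j => (t j : ℂ)) k (m + 1)).mulVec v =
      (1 + (t (k + m) : ℂ) * μ) • F.mulVec v + (t (k + m) : ℂ) • F.mulVec (N.mulVec v) := by
    change ((1 + (t (k + m) : ℂ) • A) * F).mulVec v = _
    rw [← Matrix.mulVec_mulVec, Matrix.add_mulVec, Matrix.one_mulVec, Matrix.smul_mulVec]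
    rw [Matrix.mulVec_mulVec v F N, hc.eq, ← Matrix.mulVec_mulVec]
    conv_lhs => rw [hA]
    rw [Matrix.add_mulVec, hsc, smul_add, smul_smul, add_smul, one_smul, add_assoc]
  rw [heq]
  refine (norm_add_le _ _).trans ?_
  rw [norm_smul, norm_smul, Complex.norm_real, Real.norm_of_nonneg (ht _)]
  gcongr
  exact norm_one_add_ofReal_mul_le μ _

/-- Induction on the nilpotency order: summing the contribution of `N v` over the steps costs one
extra power of `stepSum`. -/
lemma exists_norm_propagator_le (ht : ∀ j, 0 ≤ t j) {τ : ℝ} (hτ : ∀ j, t j ≤ τ) (μ : ℂ) (d : ℕ) :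
    ∀ v : Fin q → ℂ, ((A - Matrix.scalar (Fin q) μ) ^ (d + 1)).mulVec v = 0 →
    ∃ C, 0 ≤ C ∧ ∀ k m, ‖(propagator A (fun j => (t j : ℂ)) k m).mulVec v‖ ≤
      C * Real.exp (μ.re * stepSum t k m + ‖μ‖ ^ 2 / 2 * stepSum (fun j => t j ^ 2) k m) *
        (1 + stepSum t k m) ^ d := by
  set R : ℕ → ℕ → ℝ := fun k m =>
    Real.exp (μ.re * stepSum t k m + ‖μ‖ ^ 2 / 2 * stepSum (fun j => t j ^ 2) k m) with hR
  have hRs : ∀ k m, R k (m + 1) =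
      Real.exp (μ.re * t (k + m) + ‖μ‖ ^ 2 / 2 * t (k + m) ^ 2) * R k m := by
    intro k m
    simp only [hR, stepSum, Finset.sum_range_succ, ← Real.exp_add]
    congr 1; ring
  have hRpos : ∀ k m, 0 < R k m := fun k m => Real.exp_pos _
  induction d with
  | zero =>
    intro v hv
    refine ⟨‖v‖, norm_nonneg _, fun k m => ?_⟩
    rw [pow_zero, mul_one]
    induction m with
    | zero => simp [propagator, stepSum]
    | succ m ih =>
      refine (norm_propagator_succ_le ht μ v k m).trans ?_
      rw [zero_add, pow_one] at hv
      rw [hv, Matrix.mulVec_zero, norm_zero, mul_zero, add_zero]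
      change _ ≤ ‖v‖ * R k (m + 1)
      rw [hRs, mul_left_comm]
      gcongr
  | succ d ihd =>
    intro v hv
    obtain ⟨C, hC, hb⟩ := ihd ((A - Matrix.scalar (Fin q) μ).mulVec v) (by
      rw [Matrix.mulVec_mulVec, ← pow_succ]; exact hv)
    -- The one-step factor may be below 1 when `μ.re < 0`; `E` compensates, so the term with `N v`
    -- can also be compared with `R k (m + 1)`.
    set E := Real.exp (|μ.re| * τ) with hE
    have hE0 : 0 ≤ E := Real.exp_nonneg _
    have hEρ : ∀ j, 1 ≤ E * Real.exp (μ.re * t j + ‖μ‖ ^ 2 / 2 * t j ^ 2) := by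
      intro j
      rw [hE, ← Real.exp_add]
      refine Real.one_le_exp ?_
      have h1 : -(|μ.re| * τ) ≤ μ.re * t j := by
        have := mul_le_mul_of_nonneg_left (hτ j) (abs_nonneg μ.re)
        nlinarith [neg_abs_le μ.re, ht j]
      have : 0 ≤ ‖μ‖ ^ 2 / 2 * t j ^ 2 := by positivity
      linarith
    have key : ∀ k m, ‖(propagator A (fun j => (t j : ℂ)) k m).mulVec v‖ ≤
        R k m * (‖v‖ + C * E * (stepSum t k m * (1 + stepSum t k m) ^ d)) := by
      intro k m
      induction m with
      | zero => simp [propagator, stepSum, hR]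
      | succ m ih =>
        refine (norm_propagator_succ_le ht μ v k m).trans ?_
        have h1 := hb k m
        have hs := stepSum_nonneg ht k m
        have hss : stepSum t k (m + 1) = stepSum t k m + t (k + m) := by
          simp [stepSum, Finset.sum_range_succ]
        set s := stepSum t k m
        rw [hRs, hss]
        set ρ := Real.exp (μ.re * t (k + m) + ‖μ‖ ^ 2 / 2 * t (k + m) ^ 2)
        have hρ := hEρ (k + m)
        have h0 := ht (k + m)
        change _ ≤ C * R k m * (1 + s) ^ d at h1
        have hRk := (hRpos k m).le
        calc _ ≤ ρ * (R k m * (‖v‖ + C * E * (s * (1 + s) ^ d))) +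
              t (k + m) * (C * R k m * (1 + s) ^ d) := by gcongr
          _ ≤ ρ * (R k m * (‖v‖ + C * E * (s * (1 + s) ^ d))) +
              (E * ρ) * (t (k + m) * (C * R k m * (1 + s) ^ d)) := by
            refine add_le_add le_rfl (le_mul_of_one_le_left (by positivity) hρ)
          _ = ρ * R k m * (‖v‖ + C * E * ((s + t (k + m)) * (1 + s) ^ d)) := by ring
          _ ≤ _ := by
            gcongr
            linarith
    refine ⟨‖v‖ + C * E, by positivity, fun k m => (key k m).trans ?_⟩
    have hs := stepSum_nonneg ht k m
    set s := stepSum t k m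
    change _ ≤ (‖v‖ + C * E) * R k m * (1 + s) ^ (d + 1)
    have h1 : 1 ≤ (1 + s) ^ (d + 1) := one_le_pow₀ (by linarith)
    have h2 : s * (1 + s) ^ d ≤ (1 + s) ^ (d + 1) := by
      rw [pow_succ, mul_comm]; gcongr; linarith
    have hRk := (hRpos k m).le
    calc _ ≤ R k m * (‖v‖ * (1 + s) ^ (d + 1) + C * E * (1 + s) ^ (d + 1)) := by
          gcongr
          exact le_mul_of_one_le_right (norm_nonneg v) h1
      _ = _ := by ring

/-- The images of `v` under the propagators grow at most like `exp (σ s) * (1 + s) ^ κ`. -/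
def HasGrowth (A : Matrix (Fin q) (Fin q) ℂ) (t : ℕ → ℝ) (σ : ℝ) (κ : ℕ) (v : Fin q → ℂ) : Prop :=
  ∃ C, 0 ≤ C ∧ ∀ k m, ‖(propagator A (fun j => (t j : ℂ)) k m).mulVec v‖ ≤
    C * (Real.exp (σ * stepSum t k m) * (1 + stepSum t k m) ^ κ)

lemma HasGrowth.zero (σ : ℝ) (κ : ℕ) : HasGrowth A t σ κ 0 :=
  ⟨0, le_rfl, fun k m => by simp⟩

lemma HasGrowth.add {σ : ℝ} {κ : ℕ} {v w : Fin q → ℂ}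
    (hv : HasGrowth A t σ κ v) (hw : HasGrowth A t σ κ w) : HasGrowth A t σ κ (v + w) := by
  obtain ⟨C, hC, h⟩ := hv
  obtain ⟨D, hD, h'⟩ := hw
  refine ⟨C + D, by positivity, fun k m => ?_⟩
  rw [Matrix.mulVec_add, add_mul]
  exact (norm_add_le _ _).trans (add_le_add (h k m) (h' k m))

/-- The quadratic part of the exponent is bounded through `T`. If `μ.re < σ`, the spare exponential
absorbs the polynomial, whatever `d` and `κ` are. -/
lemma hasGrowth_of_pow_mulVec_eq_zero (ht : ∀ j, 0 ≤ t j) {τ : ℝ} (hτ : ∀ j, t j ≤ τ) {T : ℝ}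
    (hT : ∀ k m, stepSum (fun j => t j ^ 2) k m ≤ T) {σ : ℝ} {κ d : ℕ} {μ : ℂ}
    (h : μ.re < σ ∨ μ.re = σ ∧ d ≤ κ) {v : Fin q → ℂ}
    (hv : ((A - Matrix.scalar (Fin q) μ) ^ (d + 1)).mulVec v = 0) : HasGrowth A t σ κ v := by
  obtain ⟨C, hC, hb⟩ := exists_norm_propagator_le ht hτ μ d v hv
  obtain ⟨D, hD, hDb⟩ : ∃ D, 0 ≤ D ∧ ∀ s, 0 ≤ s →
      Real.exp (μ.re * s) * (1 + s) ^ d ≤ D * (Real.exp (σ * s) * (1 + s) ^ κ) := by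
    rcases h with h | ⟨h, hd⟩
    · set ε := σ - μ.re with hε
      have hε0 : 0 < ε := by linarith
      refine ⟨(d.factorial : ℝ) / ε ^ d * Real.exp ε, by positivity, fun s hs => ?_⟩
      have h1 := Real.pow_div_factorial_le_exp (ε * (1 + s)) (by positivity) d
      have h2 : (1 + s) ^ d ≤ (d.factorial : ℝ) / ε ^ d * Real.exp (ε * (1 + s)) := by
        rw [div_mul_eq_mul_div, le_div_iff₀ (by positivity), ← mul_pow, mul_comm (1 + s)]
        rwa [div_le_iff₀' (by positivity)] at h1
      have h3 : 1 ≤ (1 + s) ^ κ := one_le_pow₀ (by linarith)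
      calc _ ≤ Real.exp (μ.re * s) * ((d.factorial : ℝ) / ε ^ d * Real.exp (ε * (1 + s))) := by
            gcongr
        _ = (d.factorial : ℝ) / ε ^ d * Real.exp ε * Real.exp (σ * s) := by
            rw [mul_left_comm, ← Real.exp_add, mul_assoc, ← Real.exp_add]
            congr 2; rw [hε]; ring
        _ ≤ _ := by
            gcongr
            exact le_mul_of_one_le_right (Real.exp_nonneg _) h3
    · refine ⟨1, zero_le_one, fun s hs => ?_⟩
      rw [one_mul, h]
      gcongr
      linarith
  refine ⟨C * (Real.exp (‖μ‖ ^ 2 / 2 * T) * D), by positivity, fun k m => (hb k m).trans ?_⟩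
  have h1 := hDb _ (stepSum_nonneg ht k m)
  have hs := stepSum_nonneg ht k m
  rw [Real.exp_add]
  have h2 : Real.exp (‖μ‖ ^ 2 / 2 * stepSum (fun j => t j ^ 2) k m) ≤
      Real.exp (‖μ‖ ^ 2 / 2 * T) := by
    gcongr; exact hT k m
  calc _ = C * (Real.exp (‖μ‖ ^ 2 / 2 * stepSum (fun j => t j ^ 2) k m) *
        (Real.exp (μ.re * stepSum t k m) * (1 + stepSum t k m) ^ d)) := by ring
    _ ≤ C * (Real.exp (‖μ‖ ^ 2 / 2 * T) *
        (D * (Real.exp (σ * stepSum t k m) * (1 + stepSum t k m) ^ κ))) := by gcongr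
    _ = _ := by ring

end Growth

/-! ### Vectors of activity zero avoid the generalized eigenspace of `b`. -/

section Spectral

variable {q : ℕ} {A : Matrix (Fin q) (Fin q) ℂ}

lemma pow_sub_scalar_mulVec_eq_zero {μ : ℂ} {v : Fin q → ℂ}
    (hv : v ∈ Module.End.maxGenEigenspace (Matrix.toLin' A) μ) :
    ((A - Matrix.scalar (Fin q) μ) ^ (jordanNu A μ + 1)).mulVec v = 0 := by
  have hconv : ∀ (k : ℕ) (x : Fin q → ℂ), ((A - Matrix.scalar (Fin q) μ) ^ k).mulVec x =
      ((Matrix.toLin' A - algebraMap ℂ (Module.End ℂ (Fin q → ℂ)) μ) ^ k) x := by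
    intro k x
    have : Matrix.toLin' A - algebraMap ℂ (Module.End ℂ (Fin q → ℂ)) μ =
        Matrix.toLin' (A - Matrix.scalar (Fin q) μ) := by
      ext1 i
      ext j
      simp [Module.algebraMap_end_apply, Pi.single_apply]
    rw [this, ← Matrix.toLin'_pow, Matrix.toLin'_apply]
  -- Finite dimension makes the set nonempty, so the infimum defining `jordanNu` is attained rather
  -- than being the default value 0.
  have hne : {k : ℕ | ∀ v ∈ Module.End.maxGenEigenspace (Matrix.toLin' A) μ,
      ((A - Matrix.scalar (Fin q) μ) ^ (k + 1)).mulVec v = 0}.Nonempty := by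
    refine ⟨Module.finrank ℂ (Fin q → ℂ), fun x hx => ?_⟩
    rw [Module.End.maxGenEigenspace_eq_genEigenspace_finrank, Module.End.mem_genEigenspace_nat,
      LinearMap.mem_ker] at hx
    rw [pow_succ', ← Matrix.mulVec_mulVec, hconv]
    rw [← Algebra.algebraMap_eq_smul_one] at hx
    rw [hx, Matrix.mulVec_zero]
  exact Nat.sInf_mem hne v hv

lemma mem_roots_of_mem_maxGenEigenspace {μ : ℂ} {v : Fin q → ℂ} (hv0 : v ≠ 0)
    (hv : v ∈ Module.End.maxGenEigenspace (Matrix.toLin' A) μ) : μ ∈ A.charpoly.roots := by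
  have h := LinearMap.finrank_maxGenEigenspace_eq (Matrix.toLin' A) μ
  rw [Matrix.charpoly_toLin'] at h
  rw [← Multiset.count_pos, Polynomial.count_roots, ← h]
  have : Nontrivial (Module.End.maxGenEigenspace (Matrix.toLin' A) μ) :=
    ⟨⟨v, hv⟩, 0, fun h => hv0 (congrArg Subtype.val h)⟩
  exact Module.finrank_pos

/-- The left eigenvector `a` kills every generalized eigenspace with `μ ≠ b`. Since `b` is simple,
its generalized eigenspace is a line, on which `a` cannot vanish because `a ≠ 0`. So `a ⬝ᵥ v = 0`
removes the component of `v` on that line. -/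
lemma mem_iSup_maxGenEigenspace_ne {a : Fin q → ℂ} (ha : a ≠ 0) {b : ℂ}
    (hab : Matrix.vecMul a A = b • a) (hb : A.charpoly.roots.count b = 1) {v : Fin q → ℂ}
    (hv : a ⬝ᵥ v = 0) :
    v ∈ ⨆ μ : {μ : ℂ // μ ≠ b}, Module.End.maxGenEigenspace (Matrix.toLin' A) μ := by
  set W := ⨆ μ : {μ : ℂ // μ ≠ b}, Module.End.maxGenEigenspace (Matrix.toLin' A) μ with hW
  have hsup : Module.End.maxGenEigenspace (Matrix.toLin' A) b ⊔ W = ⊤ := by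
    rw [← Module.End.iSup_maxGenEigenspace_eq_top (Matrix.toLin' A), iSup_split_single _ b, hW,
      iSup_subtype]
  have hpow : ∀ (μ : ℂ) (k : ℕ) (x : Fin q → ℂ),
      a ⬝ᵥ ((A - Matrix.scalar (Fin q) μ) ^ k).mulVec x = (b - μ) ^ k * (a ⬝ᵥ x) := by
    intro μ k
    induction k with
    | zero => simp
    | succ k ih =>
      intro x
      have hs : Matrix.vecMul a (Matrix.scalar (Fin q) μ) = μ • a := by
        ext i; simp [Matrix.vecMul_diagonal, mul_comm]
      rw [pow_succ, ← Matrix.mulVec_mulVec, ih, Matrix.dotProduct_mulVec, Matrix.vecMul_sub, hab,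
        hs, ← sub_smul, smul_dotProduct, smul_eq_mul]
      ring
  have hWa : ∀ y ∈ W, a ⬝ᵥ y = 0 := by
    intro y hy
    refine Submodule.iSup_induction _ (motive := fun y => a ⬝ᵥ y = 0) hy ?_ (by simp) ?_
    · rintro ⟨μ, hμ⟩ x hx
      have h := hpow μ (jordanNu A μ + 1) x
      rw [pow_sub_scalar_mulVec_eq_zero hx, dotProduct_zero, eq_comm, mul_eq_zero] at h
      exact h.resolve_left (pow_ne_zero _ (sub_ne_zero.2 hμ.symm))
    · intro x y hx hy
      rw [dotProduct_add, hx, hy, add_zero]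
  have hfr : Module.finrank ℂ (Module.End.maxGenEigenspace (Matrix.toLin' A) b) = 1 := by
    rw [LinearMap.finrank_maxGenEigenspace_eq, Matrix.charpoly_toLin', ← Polynomial.count_roots, hb]
  obtain ⟨x, hx, y, hy, rfl⟩ := Submodule.mem_sup.1 (hsup ▸ Submodule.mem_top : v ∈ _)
  rw [dotProduct_add, hWa y hy, add_zero] at hv
  obtain ⟨⟨x₀, hx₀⟩, hne, hspan⟩ := finrank_eq_one_iff'.1 hfr
  have hax₀ : a ⬝ᵥ x₀ ≠ 0 := by
    intro h0
    refine ha (dotProduct_eq_zero a fun z => ?_)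
    obtain ⟨x', hx', y', hy', rfl⟩ := Submodule.mem_sup.1 (hsup ▸ Submodule.mem_top : z ∈ _)
    obtain ⟨c, hc⟩ := hspan ⟨x', hx'⟩
    have hc' : c • x₀ = x' := congrArg Subtype.val hc
    rw [dotProduct_add, hWa y' hy', ← hc', dotProduct_smul, h0]
    simp
  obtain ⟨c, hc⟩ := hspan ⟨x, hx⟩
  have hc' : c • x₀ = x := congrArg Subtype.val hc
  rw [← hc', dotProduct_smul, smul_eq_mul, mul_eq_zero] at hv
  rw [← hc', hv.resolve_right hax₀, zero_smul, zero_add]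
  exact hy

lemma hasGrowth_of_dotProduct_eq_zero {t : ℕ → ℝ} (ht : ∀ j, 0 ≤ t j) {τ : ℝ}
    (hτ : ∀ j, t j ≤ τ) {T : ℝ} (hT : ∀ k m, stepSum (fun j => t j ^ 2) k m ≤ T)
    {a : Fin q → ℂ} (ha : a ≠ 0) {b : ℂ}
    (hab : Matrix.vecMul a A = b • a) (hb : A.charpoly.roots.count b = 1) {σ : ℝ} {κ : ℕ}
    (hroots : ∀ μ ∈ A.charpoly.roots, μ ≠ b → μ.re < σ ∨ μ.re = σ ∧ jordanNu A μ ≤ κ)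
    {v : Fin q → ℂ} (hv : a ⬝ᵥ v = 0) : HasGrowth A t σ κ v := by
  refine Submodule.iSup_induction _ (motive := HasGrowth A t σ κ)
    (mem_iSup_maxGenEigenspace_ne ha hab hb hv) ?_ (HasGrowth.zero σ κ) fun _ _ => HasGrowth.add
  rintro ⟨μ, hμ⟩ x hx
  -- The supremum runs over all `μ ≠ b`; only a nonzero vector certifies that `μ` is an eigenvalue.
  rcases eq_or_ne x 0 with rfl | hx0
  · exact HasGrowth.zero σ κ
  · exact hasGrowth_of_pow_mulVec_eq_zero ht hτ hT
      (hroots μ (mem_roots_of_mem_maxGenEigenspace hx0 hx) hμ) (pow_sub_scalar_mulVec_eq_zero hx)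

end Spectral


/-! ### Sums over an arithmetic progression of weights -/

section Progression

variable {w₀ b : ℝ}

/-- The reciprocals of the total activities `w₀ + j * b` of a balanced urn. -/
def invWeight (w₀ b : ℝ) (j : ℕ) : ℝ := (w₀ + j * b)⁻¹

lemma weight_pos (hw : 0 < w₀) (hb : 0 < b) (j : ℕ) : 0 < w₀ + j * b := by positivity

lemma invWeight_pos (hw : 0 < w₀) (hb : 0 < b) (j : ℕ) : 0 < invWeight w₀ b j :=
  inv_pos.2 (weight_pos hw hb j)

lemma invWeight_le (hw : 0 < w₀) (hb : 0 < b) (j : ℕ) : invWeight w₀ b j ≤ w₀⁻¹ :=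
  inv_anti₀ hw (le_add_of_nonneg_right (by positivity))

/-- Each square is at most a constant times the difference of consecutive reciprocals, so the sum
telescopes. -/
lemma stepSum_invWeight_sq_le (hw : 0 < w₀) (hb : 0 < b) (k m : ℕ) :
    stepSum (fun j => invWeight w₀ b j ^ 2) k m ≤ (1 + b / w₀) / b * w₀⁻¹ := by
  have hstep : ∀ j, invWeight w₀ b j ^ 2 ≤
      (1 + b / w₀) / b * (invWeight w₀ b j - invWeight w₀ b (j + 1)) := by
    intro j
    have h1 := weight_pos hw hb j
    have h2 := weight_pos hw hb (j + 1)
    have e : invWeight w₀ b j - invWeight w₀ b (j + 1) =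
        b * (invWeight w₀ b j * invWeight w₀ b (j + 1)) := by
      unfold invWeight; push_cast at *; field_simp; ring
    have e2 : invWeight w₀ b j = (1 + b * invWeight w₀ b j) * invWeight w₀ b (j + 1) := by
      unfold invWeight; push_cast at *; field_simp; ring
    have h3 : 1 + b * invWeight w₀ b j ≤ 1 + b / w₀ := by
      rw [div_eq_mul_inv]; gcongr; exact invWeight_le hw hb j
    have p1 := invWeight_pos hw hb j
    have p2 := invWeight_pos hw hb (j + 1)
    calc invWeight w₀ b j ^ 2 = invWeight w₀ b j * invWeight w₀ b j := sq _
      _ = invWeight w₀ b j * ((1 + b * invWeight w₀ b j) * invWeight w₀ b (j + 1)) :=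
          congrArg (invWeight w₀ b j * ·) e2
      _ = (1 + b * invWeight w₀ b j) * (invWeight w₀ b j * invWeight w₀ b (j + 1)) := by ring
      _ ≤ (1 + b / w₀) * (invWeight w₀ b j * invWeight w₀ b (j + 1)) := by gcongr
      _ = _ := by rw [e]; field_simp
  have key : ∀ m, stepSum (fun j => invWeight w₀ b j ^ 2) k m ≤
      (1 + b / w₀) / b * (invWeight w₀ b k - invWeight w₀ b (k + m)) := by
    intro m
    induction m with
    | zero => simp [stepSum]
    | succ m ih =>
      have h := hstep (k + m)
      have : stepSum (fun j => invWeight w₀ b j ^ 2) k (m + 1) =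
          stepSum (fun j => invWeight w₀ b j ^ 2) k m + invWeight w₀ b (k + m) ^ 2 := by
        simp [stepSum, Finset.sum_range_succ]
      rw [this, ← add_assoc]
      linarith
  refine (key m).trans ?_
  gcongr
  linarith [invWeight_le hw hb k, invWeight_pos hw hb (k + m)]

/-- With `w_j = w₀ + j b`, `b / w_{j+1} = 1 - w_j / w_{j+1} ≤ log (w_{j+1} / w_j)`. Starting the sum
at `k + 1` leaves no additive constant. -/
lemma stepSum_invWeight_le (hw : 0 < w₀) (hb : 0 < b) (k m : ℕ) :
    b * stepSum (invWeight w₀ b) (k + 1) m ≤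
      Real.log (w₀ + (k + m : ℕ) * b) - Real.log (w₀ + k * b) := by
  induction m with
  | zero => simp [stepSum]
  | succ m ih =>
    have h1 := weight_pos hw hb (k + m)
    have h2 := weight_pos hw hb (k + m + 1)
    have h3 : stepSum (invWeight w₀ b) (k + 1) (m + 1) =
        stepSum (invWeight w₀ b) (k + 1) m + invWeight w₀ b (k + m + 1) := by
      simp only [stepSum, Finset.sum_range_succ]
      congr 2; omega
    have h4 := Real.one_sub_inv_le_log_of_pos (div_pos h2 h1)
    rw [Real.log_div h2.ne' h1.ne', inv_div] at h4
    have h5 : b * invWeight w₀ b (k + m + 1) =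
        1 - (w₀ + (k + m : ℕ) * b) / (w₀ + (k + m + 1 : ℕ) * b) := by
      unfold invWeight
      rw [eq_sub_iff_add_eq, ← div_eq_mul_inv, ← add_div, div_eq_one_iff_eq h2.ne']
      push_cast; ring
    rw [h3, mul_add, h5, ← add_assoc k m 1]
    linarith

/-- Induction on `n`: a step multiplies all old terms by one common ratio, bounded by Bernoulli's
inequality. The constant solves `C b (1 - θ) = 1 + θ b / w₀`, which is what closes the induction. -/
lemma sum_rpow_div_le (hw : 0 < w₀) (hb : 0 < b) {θ : ℝ} (h0 : 0 ≤ θ) (h1 : θ < 1) (n : ℕ) :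
    ∑ k ∈ Finset.range n, ((w₀ + n * b) / (w₀ + k * b)) ^ θ ≤
      (1 + θ * b / w₀) / (b * (1 - θ)) * (w₀ + n * b) := by
  have h1' : 0 < 1 - θ := by linarith
  set C := (1 + θ * b / w₀) / (b * (1 - θ)) with hC
  have hC0 : 0 ≤ C := by positivity
  have hCb : C * (b * (1 - θ)) = 1 + θ * b / w₀ := div_mul_cancel₀ _ (by positivity)
  induction n with
  | zero => simp; positivity
  | succ n ih =>
    have hn := weight_pos hw hb n
    have hn1 := weight_pos hw hb (n + 1)
    have hfac : ∑ k ∈ Finset.range (n + 1), ((w₀ + (n + 1 : ℕ) * b) / (w₀ + k * b)) ^ θ =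
        ((w₀ + (n + 1 : ℕ) * b) / (w₀ + n * b)) ^ θ *
          (∑ k ∈ Finset.range n, ((w₀ + n * b) / (w₀ + k * b)) ^ θ + 1) := by
      rw [Finset.sum_range_succ, mul_add, mul_one, Finset.mul_sum]
      congr 1
      refine Finset.sum_congr rfl fun k _ => ?_
      have hk := weight_pos hw hb k
      rw [← Real.mul_rpow (by positivity) (by positivity)]
      congr 1
      field_simp
    have hbern : ((w₀ + (n + 1 : ℕ) * b) / (w₀ + n * b)) ^ θ ≤ 1 + θ * (b / (w₀ + n * b)) := by
      have e : (w₀ + (n + 1 : ℕ) * b) / (w₀ + n * b) = 1 + b / (w₀ + n * b) := by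
        push_cast; field_simp; ring
      rw [e]
      exact rpow_one_add_le_one_add_mul_self (by linarith [div_pos hb hn]) h0 h1.le
    rw [hfac]
    calc _ ≤ (1 + θ * (b / (w₀ + n * b))) * (C * (w₀ + n * b) + 1) := by gcongr
      _ = C * (w₀ + n * b) + 1 + θ * b * C + θ * (b / (w₀ + n * b)) := by field_simp; ring
      _ ≤ C * (w₀ + n * b) + 1 + θ * b * C + θ * (b / w₀) := by
          gcongr
          exact le_add_of_nonneg_right (by positivity)
      _ = C * (w₀ + n * b) + C * b + (1 + θ * b / w₀ - C * (b * (1 - θ))) := by ring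
      _ = _ := by rw [hCb]; push_cast; ring

/-- The bound on the growth of the propagator from time `k + 1` to time `n`. -/
def growthFactor (w₀ b σ : ℝ) (κ n k : ℕ) : ℝ :=
  Real.exp (σ * stepSum (invWeight w₀ b) (k + 1) (n - 1 - k)) *
    (1 + stepSum (invWeight w₀ b) (k + 1) (n - 1 - k)) ^ κ

lemma growthFactor_nonneg (hw : 0 < w₀) (hb : 0 < b) (σ : ℝ) (κ n k : ℕ) :
    0 ≤ growthFactor w₀ b σ κ n k := by
  have := stepSum_nonneg (fun j => (invWeight_pos hw hb j).le) (k + 1) (n - 1 - k)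
  unfold growthFactor; positivity

lemma stepSum_invWeight_le' (hw : 0 < w₀) (hb : 0 < b) {k n : ℕ} (hk : k < n) :
    b * stepSum (invWeight w₀ b) (k + 1) (n - 1 - k) ≤
      Real.log (w₀ + n * b) - Real.log (w₀ + k * b) := by
  refine (stepSum_invWeight_le hw hb k (n - 1 - k)).trans ?_
  have : k + (n - 1 - k) ≤ n := by omega
  gcongr

/-- The squared factor is at most `(w_n / w_k) ^ θ` with `θ = 2 σ / b < 1`, so the early times `k`
do not dominate. -/
lemma sum_growthFactor_sq_le_small (hw : 0 < w₀) (hb : 0 < b) {σ : ℝ} (h0 : 0 ≤ σ)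
    (h1 : σ < b / 2) : ∃ L, 0 ≤ L ∧ ∀ n : ℕ, 1 ≤ n →
      ∑ k ∈ Finset.range n, growthFactor w₀ b σ 0 n k ^ 2 ≤ L * n := by
  set θ := 2 * σ / b with hθ
  have hθ0 : 0 ≤ θ := by positivity
  have hθ1 : θ < 1 := by rw [hθ, div_lt_one hb]; linarith
  have hθ1' : 0 < 1 - θ := by linarith
  refine ⟨(1 + θ * b / w₀) / (b * (1 - θ)) * (w₀ + b), by positivity, fun n hn => ?_⟩
  have hle : ∀ k ∈ Finset.range n, growthFactor w₀ b σ 0 n k ^ 2 ≤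
      ((w₀ + n * b) / (w₀ + k * b)) ^ θ := by
    intro k hk
    have h2 := stepSum_invWeight_le' hw hb (Finset.mem_range.1 hk)
    have hk' := weight_pos hw hb k
    have hn' := weight_pos hw hb n
    rw [growthFactor, pow_zero, mul_one, ← Real.exp_nat_mul,
      Real.rpow_def_of_pos (div_pos hn' hk'), Real.log_div hn'.ne' hk'.ne']
    rw [Real.exp_le_exp]
    calc _ = θ * (b * stepSum (invWeight w₀ b) (k + 1) (n - 1 - k)) := by
          rw [hθ]; push_cast; field_simp
      _ ≤ θ * (Real.log (w₀ + n * b) - Real.log (w₀ + k * b)) := by gcongr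
      _ = _ := mul_comm _ _
  refine (Finset.sum_le_sum hle).trans ((sum_rpow_div_le hw hb hθ0 hθ1 n).trans ?_)
  rw [mul_assoc]
  gcongr
  have : (1 : ℝ) ≤ n := by exact_mod_cast hn
  nlinarith

/-- Here the exponent is exactly 1: the squared factor is at most `w_n / w_k` times `2 κ`
logarithms, and the harmonic sum over `k` supplies one more. The range `n ≥ 2` keeps `log n` away
from 0. -/
lemma sum_growthFactor_sq_le_critical (hw : 0 < w₀) (hb : 0 < b) (κ : ℕ) :
    ∃ L, 0 ≤ L ∧ ∀ n : ℕ, 2 ≤ n →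
      ∑ k ∈ Finset.range n, growthFactor w₀ b (b / 2) κ n k ^ 2 ≤
        L * (n * Real.log n ^ (2 * κ + 1)) := by
  set Λ : ℕ → ℝ := fun n => 1 + (Real.log (w₀ + n * b) - Real.log w₀) / b with hΛ
  have hlog2 : 0 < Real.log 2 := Real.log_pos (by norm_num)
  have hΛ1 : ∀ n, 1 ≤ Λ n := by
    intro n
    have : Real.log w₀ ≤ Real.log (w₀ + n * b) :=
      Real.log_le_log hw (le_add_of_nonneg_right (by positivity))
    have : 0 ≤ (Real.log (w₀ + n * b) - Real.log w₀) / b := div_nonneg (by linarith) hb.le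
    simp only [hΛ]; linarith
  set D := (1 + Real.log (1 + b / w₀) / b) / Real.log 2 + 1 / b with hD
  have hl0 : 0 ≤ Real.log (1 + b / w₀) := Real.log_nonneg (by
    have : 0 ≤ b / w₀ := by positivity
    linarith)
  have hD0 : 0 ≤ D := by positivity
  have hΛlog : ∀ n : ℕ, 2 ≤ n → Λ n ≤ D * Real.log n := by
    intro n hn
    have hn' : (2 : ℝ) ≤ n := by exact_mod_cast hn
    have h1 : Real.log (w₀ + n * b) - Real.log w₀ ≤ Real.log (1 + b / w₀) + Real.log n := by
      rw [← Real.log_div (weight_pos hw hb n).ne' hw.ne', ← Real.log_mul (by positivity)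
        (by positivity)]
      refine Real.log_le_log (by positivity) ?_
      rw [div_le_iff₀ hw]
      have : (1 + b / w₀) * n * w₀ = (w₀ + b) * n := by field_simp
      rw [this]; nlinarith
    have h2 : Real.log 2 ≤ Real.log n := Real.log_le_log (by norm_num) hn'
    have h3 : 1 + Real.log (1 + b / w₀) / b ≤
        (1 + Real.log (1 + b / w₀) / b) / Real.log 2 * Real.log n := by
      rw [div_mul_eq_mul_div, le_div_iff₀ hlog2]
      gcongr
    calc Λ n ≤ 1 + (Real.log (1 + b / w₀) + Real.log n) / b := by
          simp only [hΛ]; gcongr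
      _ = (1 + Real.log (1 + b / w₀) / b) + 1 / b * Real.log n := by ring
      _ ≤ _ := by rw [hD, add_mul]; gcongr
  refine ⟨(1 + w₀⁻¹) * (w₀ + b) * D ^ (2 * κ + 1), by positivity, fun n hn => ?_⟩
  have hn' : (2 : ℝ) ≤ n := by exact_mod_cast hn
  have hwn := weight_pos hw hb n
  have hle : ∀ k ∈ Finset.range n, growthFactor w₀ b (b / 2) κ n k ^ 2 ≤
      (w₀ + n * b) * Λ n ^ (2 * κ) * invWeight w₀ b k := by
    intro k hk
    have h2 := stepSum_invWeight_le' hw hb (Finset.mem_range.1 hk)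
    have hk' := weight_pos hw hb k
    have hs := stepSum_nonneg (fun j => (invWeight_pos hw hb j).le) (k + 1) (n - 1 - k)
    set s := stepSum (invWeight w₀ b) (k + 1) (n - 1 - k) with hsdef
    have h3 : 1 + s ≤ Λ n := by
      have h4 : Real.log w₀ ≤ Real.log (w₀ + k * b) :=
        Real.log_le_log hw (le_add_of_nonneg_right (by positivity))
      have : s ≤ (Real.log (w₀ + n * b) - Real.log w₀) / b := by
        rw [le_div_iff₀ hb]; linarith
      simp only [hΛ]; linarith
    have h5 : Real.exp (b / 2 * s) ^ 2 ≤ (w₀ + n * b) * invWeight w₀ b k := by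
      rw [← Real.exp_nat_mul]
      calc _ = Real.exp (b * s) := by congr 1; push_cast; ring
        _ ≤ Real.exp (Real.log (w₀ + n * b) - Real.log (w₀ + k * b)) := by gcongr
        _ = _ := by rw [Real.exp_sub, Real.exp_log hwn, Real.exp_log hk', invWeight,
                      div_eq_mul_inv]
    rw [growthFactor, ← hsdef, mul_pow, ← pow_mul, mul_comm κ 2]
    calc _ ≤ ((w₀ + n * b) * invWeight w₀ b k) * Λ n ^ (2 * κ) := by
          have := (invWeight_pos hw hb k).le
          gcongr
      _ = _ := by ring
  refine (Finset.sum_le_sum hle).trans ?_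
  rw [← Finset.mul_sum]
  have hsum : ∑ k ∈ Finset.range n, invWeight w₀ b k ≤ (1 + w₀⁻¹) * Λ n := by
    obtain ⟨m, rfl⟩ : ∃ m, n = m + 1 := ⟨n - 1, by omega⟩
    rw [Finset.sum_range_succ']
    have h2 := stepSum_invWeight_le' hw hb (k := 0) (n := m + 1) (by omega)
    have e : stepSum (invWeight w₀ b) (0 + 1) (m + 1 - 1 - 0) =
        ∑ k ∈ Finset.range m, invWeight w₀ b (k + 1) := by
      simp [stepSum, add_comm]
    rw [e, Nat.cast_zero, zero_mul, add_zero] at h2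
    have h3 : ∑ k ∈ Finset.range m, invWeight w₀ b (k + 1) ≤ Λ (m + 1) - 1 := by
      simp only [hΛ, add_sub_cancel_left]
      rw [le_div_iff₀ hb]; linarith
    have h4 := hΛ1 (m + 1)
    have h5 : invWeight w₀ b 0 ≤ w₀⁻¹ * Λ (m + 1) :=
      (invWeight_le hw hb 0).trans (le_mul_of_one_le_right (by positivity) h4)
    linarith
  have h0 : 0 ≤ Λ n := by linarith [hΛ1 n]
  have hlog : 0 ≤ Real.log n := Real.log_nonneg (by linarith)
  calc _ ≤ (w₀ + n * b) * Λ n ^ (2 * κ) * ((1 + w₀⁻¹) * Λ n) := by gcongr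
    _ = (1 + w₀⁻¹) * (w₀ + n * b) * Λ n ^ (2 * κ + 1) := by ring
    _ ≤ (1 + w₀⁻¹) * ((w₀ + b) * n) * (D * Real.log n) ^ (2 * κ + 1) := by
        gcongr
        · nlinarith
        · exact hΛlog n hn
    _ = _ := by rw [mul_pow]; ring

end Progression


/-! ### The composition as a sum of martingale transforms -/

namespace PolyaUrn

variable {q : ℕ}

/-- The projection of the `j`-th basis vector along the `i₀`-th one to the vectors of activity
zero. -/
def tangent (U : PolyaUrn q) (i₀ j : Fin q) : Fin q → ℝ :=
  Pi.single j 1 - (U.activity j / U.activity i₀) • Pi.single i₀ 1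

lemma activity_dotProduct_tangent (U : PolyaUrn q) {i₀ : Fin q} (h : U.activity i₀ ≠ 0)
    (j : Fin q) : U.activity ⬝ᵥ U.tangent i₀ j = 0 := by
  simp [tangent, dotProduct_sub, h]

/-- This lets the fixed vectors `tangent i₀ j` replace the random innovation: the propagator acts
only on them, and its entries become deterministic coefficients. -/
lemma sum_smul_tangent (U : PolyaUrn q) (i₀ : Fin q) {y : Fin q → ℝ}
    (hy : U.activity ⬝ᵥ y = 0) : ∑ j, y j • U.tangent i₀ j = y := by
  have h1 : ∑ j, y j • (Pi.single j (1 : ℝ) : Fin q → ℝ) = y := by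
    ext i; simp [Finset.sum_apply, Pi.single_apply]
  have h2 : ∑ j, y j • ((U.activity j / U.activity i₀) • (Pi.single i₀ (1 : ℝ) : Fin q → ℝ)) =
      (0 : Fin q → ℝ) := by
    simp only [smul_smul, ← Finset.sum_smul]
    have : ∑ j, y j * (U.activity j / U.activity i₀) = (U.activity ⬝ᵥ y) / U.activity i₀ := by
      rw [dotProduct, Finset.sum_div]
      exact Finset.sum_congr rfl fun j _ => by ring
    rw [this, hy, zero_div, zero_smul]
  simp only [tangent, smul_sub, Finset.sum_sub_distrib, h1, h2, sub_zero]

lemma weight_eq_dotProduct (U : PolyaUrn q) (x : EuclideanSpace ℝ (Fin q)) :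
    U.weight x = U.activity ⬝ᵥ x := rfl

/-- This is the balance condition in expectation. -/
lemma vecMul_intensity (U : PolyaUrn q) {b : ℝ} (hbal : U.IsBalanced b)
    (hint : ∀ i j, Integrable (fun x : EuclideanSpace ℝ (Fin q) => x j)
      (U.replacement i : Measure (EuclideanSpace ℝ (Fin q)))) :
    Matrix.vecMul U.activity U.intensity = b • U.activity := by
  ext j
  have h : ∑ i, U.activity i *
      ∫ x, x i ∂(U.replacement j : Measure (EuclideanSpace ℝ (Fin q))) = b := by
    simp only [← integral_const_mul]
    rw [← integral_finsetSum _ fun i _ => (hint j i).const_mul _]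
    have h1 := integral_congr_ae (hbal.2 j)
    simpa [weight] using h1
  simp only [Matrix.vecMul, dotProduct, intensity, Matrix.of_apply, Pi.smul_apply, smul_eq_mul]
  rw [← h, Finset.sum_mul]
  exact Finset.sum_congr rfl fun i _ => by ring

lemma meanRepl_coord (U : PolyaUrn q) (x : EuclideanSpace ℝ (Fin q)) (j : Fin q) :
    U.meanRepl (fun y => y j) x = (U.weight x)⁻¹ * (U.intensity.mulVec x) j := by
  simp only [meanRepl, drawProb, intensity, Matrix.mulVec, dotProduct, Matrix.of_apply,
    Finset.mul_sum]
  exact Finset.sum_congr rfl fun i _ => by ring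

/-- The weight of the centred increment of coordinate `j` at time `k` in the coordinate `i` of the
composition at time `n`. -/
def coef (U : PolyaUrn q) (b : ℝ) (i₀ i j : Fin q) (n k : ℕ) : ℝ :=
  (propagator U.intensity (invWeight (U.weight U.initial) b) (k + 1) (n - 1 - k)).mulVec
    (U.tangent i₀ j) i

lemma abs_coef_le (U : PolyaUrn q) {b : ℝ} (hw : 0 < U.weight U.initial) (hb : 0 < b)
    {i₀ : Fin q} {σ : ℝ} {κ : ℕ} (hg : ∀ j, HasGrowth U.intensityC (invWeight (U.weight U.initial) b) σ κ
      fun i => (U.tangent i₀ j i : ℂ)) :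
    ∃ C, 0 ≤ C ∧ ∀ i j n k, |U.coef b i₀ i j n k| ≤
      C * growthFactor (U.weight U.initial) b σ κ n k := by
  choose C hC h using hg
  refine ⟨∑ j, C j, Finset.sum_nonneg fun j _ => hC j, fun i j n k => ?_⟩
  have h1 : ((U.coef b i₀ i j n k : ℝ) : ℂ) =
      (propagator U.intensityC (fun j => (invWeight (U.weight U.initial) b j : ℂ)) (k + 1)
        (n - 1 - k)).mulVec (fun i => (U.tangent i₀ j i : ℂ)) i := by
    have h2 := propagator_map (algebraMap ℝ ℂ) U.intensity (invWeight (U.weight U.initial) b)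
      (k + 1) (n - 1 - k)
    have h3 := RingHom.map_mulVec (algebraMap ℝ ℂ) (propagator U.intensity
      (invWeight (U.weight U.initial) b) (k + 1) (n - 1 - k)) (U.tangent i₀ j) i
    rw [h2] at h3
    exact h3
  have h4 := (norm_le_pi_norm _ i).trans (h j (k + 1) (n - 1 - k))
  rw [← h1, Complex.norm_real, Real.norm_eq_abs] at h4
  have h5 := growthFactor_nonneg hw hb σ κ n k
  refine h4.trans ?_
  change C j * growthFactor (U.weight U.initial) b σ κ n k ≤ _
  gcongr
  exact Finset.single_le_sum (f := C) (fun j _ => hC j) (Finset.mem_univ j)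

end PolyaUrn

section Urn

variable {q : ℕ} {U : PolyaUrn q} {Ω : Type*} [mΩ : MeasurableSpace Ω] {P : Measure Ω}
  [IsProbabilityMeasure P] {X : ℕ → Ω → EuclideanSpace ℝ (Fin q)} {I : ℕ → Ω → Fin q} {b : ℝ}

lemma weight_initial_pos (hX : IsPolyaUrnProcess U P X I) (hten : IsTenable U P X) :
    0 < U.weight U.initial := by
  obtain ⟨ω, h1, h2⟩ := (hX.initial.and (hten 0)).exists
  rw [← h1]; exact h2.2

lemma ae_weight_eq (hX : IsPolyaUrnProcess U P X I) (hten : IsTenable U P X)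
    (hbal : U.IsBalanced b) (n : ℕ) :
    ∀ᵐ ω ∂P, U.weight (X n ω) = U.weight U.initial + n * b := by
  induction n with
  | zero =>
    filter_upwards [hX.initial] with ω h
    simp [h]
  | succ n ih =>
    filter_upwards [ih, ae_increment hX hten n hbal.2] with ω h1 h2
    have h3 : U.weight (X (n + 1) ω) = U.weight (X n ω) + U.weight (X (n + 1) ω - X n ω) := by
      simp only [PolyaUrn.weight, ← Finset.sum_add_distrib, PiLp.sub_apply]
      exact Finset.sum_congr rfl fun i _ => by ring
    rw [h3, h1, h2]; push_cast; ring

/-- The vector of the centred increments of all coordinates. -/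
def innovVec (U : PolyaUrn q) (X : ℕ → Ω → EuclideanSpace ℝ (Fin q)) (n : ℕ) (ω : Ω) :
    Fin q → ℝ := fun j => U.innov X (fun x => x j) n ω

/-- The conditional mean of the increment is `A X_n` divided by the total activity; balance makes
the divisor nonrandom, hence the recursion linear. -/
lemma ae_composition_succ (hX : IsPolyaUrnProcess U P X I) (hten : IsTenable U P X)
    (hbal : U.IsBalanced b) (n : ℕ) : ∀ᵐ ω ∂P, (X (n + 1) ω : Fin q → ℝ) =
      (1 + invWeight (U.weight U.initial) b n • U.intensity).mulVec (X n ω) +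
        innovVec U X n ω := by
  filter_upwards [ae_weight_eq hX hten hbal n] with ω h
  ext j
  simp only [innovVec, PolyaUrn.innov, U.meanRepl_coord, h, Matrix.add_mulVec, Matrix.one_mulVec,
    Matrix.smul_mulVec, Pi.add_apply, Pi.smul_apply, smul_eq_mul, PiLp.sub_apply, invWeight]
  ring

/-- The activity increases by exactly `b`, which is also its conditional mean increase, so nothing
random is left in this direction. -/
lemma ae_activity_dotProduct_innovVec (hX : IsPolyaUrnProcess U P X I) (hten : IsTenable U P X)
    (hbal : U.IsBalanced b) (hint : ∀ i j, Integrable (fun x : EuclideanSpace ℝ (Fin q) => x j)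
      (U.replacement i : Measure (EuclideanSpace ℝ (Fin q)))) (n : ℕ) :
    ∀ᵐ ω ∂P, U.activity ⬝ᵥ innovVec U X n ω = 0 := by
  filter_upwards [ae_composition_succ hX hten hbal n, ae_weight_eq hX hten hbal n,
    ae_weight_eq hX hten hbal (n + 1)] with ω h1 h2 h3
  rw [U.weight_eq_dotProduct] at h2 h3
  rw [h1, dotProduct_add, Matrix.dotProduct_mulVec, Matrix.vecMul_add, Matrix.vecMul_one,
    Matrix.vecMul_smul, U.vecMul_intensity hbal hint, add_dotProduct, smul_dotProduct,
    smul_dotProduct, h2] at h3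
  have := weight_pos (weight_initial_pos hX hten) hbal.1 n
  simp only [invWeight, smul_eq_mul] at h3
  rw [mul_left_comm, inv_mul_cancel₀ this.ne'] at h3
  push_cast at h3
  linarith

lemma integrable_coord (hX : IsPolyaUrnProcess U P X I) (hten : IsTenable U P X)
    (hint : ∀ i j, Integrable (fun x : EuclideanSpace ℝ (Fin q) => x j)
      (U.replacement i : Measure (EuclideanSpace ℝ (Fin q)))) (n : ℕ) (j : Fin q) :
    Integrable (fun ω => X n ω j) P := by
  induction n with
  | zero =>
    refine (integrable_const (U.initial j)).congr ?_
    filter_upwards [hX.initial] with ω h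
    rw [h]
  | succ n ih =>
    refine (ih.add (integrable_comp_increment hX hten n (fun i => hint i j))).congr
      (ae_of_all _ fun ω => ?_)
    simp

/-- The deviation of the composition from its mean. -/
def deviation (P : Measure Ω) (X : ℕ → Ω → EuclideanSpace ℝ (Fin q)) (n : ℕ) (ω : Ω) :
    Fin q → ℝ := fun i => X n ω i - ∫ ω', X n ω' i ∂P

lemma ae_deviation_succ (hX : IsPolyaUrnProcess U P X I) (hten : IsTenable U P X)
    (hbal : U.IsBalanced b) (hint : ∀ i j, Integrable (fun x : EuclideanSpace ℝ (Fin q) => x j)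
      (U.replacement i : Measure (EuclideanSpace ℝ (Fin q)))) (n : ℕ) :
    ∀ᵐ ω ∂P, deviation P X (n + 1) ω =
      (1 + invWeight (U.weight U.initial) b n • U.intensity).mulVec (deviation P X n ω) +
        innovVec U X n ω := by
  set M := 1 + invWeight (U.weight U.initial) b n • U.intensity with hM
  have hmean : (fun i => ∫ ω, X (n + 1) ω i ∂P) = M.mulVec fun i => ∫ ω, X n ω i ∂P := by
    ext i
    have h1 : ∫ ω, X (n + 1) ω i ∂P =
        ∫ ω, (∑ j, M i j * X n ω j + U.innov X (fun x => x i) n ω) ∂P := by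
      refine integral_congr_ae ?_
      filter_upwards [ae_composition_succ hX hten hbal n] with ω h
      exact congrFun h i
    have h2 := integral_mul_innov hX hten n (fun k => hint k i) (h := fun _ => 1)
      measurable_const (by simpa using integrable_innov hX hten n (fun k => hint k i))
    simp only [one_mul] at h2
    rw [h1, integral_add (integrable_finsetSum _ fun j _ =>
      (integrable_coord hX hten hint n j).const_mul _)
      (integrable_innov hX hten n (fun k => hint k i)), h2, add_zero,
      integral_finsetSum _ fun j _ => (integrable_coord hX hten hint n j).const_mul _]
    simp only [integral_const_mul]
    rfl
  filter_upwards [ae_composition_succ hX hten hbal n] with ω h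
  have e : ∀ m, deviation P X m ω = (X m ω : Fin q → ℝ) - fun i => ∫ ω', X m ω' i ∂P :=
    fun m => rfl
  rw [e, e, h, hmean, ← hM, Matrix.mulVec_sub]
  abel

/-- Variation of constants; there is no initial term because `X 0` is nonrandom. -/
lemma ae_deviation_eq_sum (hX : IsPolyaUrnProcess U P X I) (hten : IsTenable U P X)
    (hbal : U.IsBalanced b) (hint : ∀ i j, Integrable (fun x : EuclideanSpace ℝ (Fin q) => x j)
      (U.replacement i : Measure (EuclideanSpace ℝ (Fin q)))) (n : ℕ) :
    ∀ᵐ ω ∂P, deviation P X n ω = ∑ k ∈ Finset.range n,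
      (propagator U.intensity (invWeight (U.weight U.initial) b) (k + 1) (n - 1 - k)).mulVec
        (innovVec U X k ω) := by
  induction n with
  | zero =>
    have h0 : ∀ i, ∫ ω, X 0 ω i ∂P = U.initial i := by
      intro i
      rw [integral_congr_ae (g := fun _ => U.initial i)
        (by filter_upwards [hX.initial] with ω h; rw [h])]
      simp
    filter_upwards [hX.initial] with ω h
    ext i
    simp [deviation, h0, h]
  | succ n ih =>
    filter_upwards [ih, ae_deviation_succ hX hten hbal hint n] with ω h1 h2
    rw [h2, h1, Finset.sum_range_succ, Matrix.mulVec_sum]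
    congr 1
    · refine Finset.sum_congr rfl fun k hk => ?_
      have hk' := Finset.mem_range.1 hk
      have e1 : n + 1 - 1 - k = (n - 1 - k) + 1 := by omega
      have e2 : k + 1 + (n - 1 - k) = n := by omega
      rw [e1, propagator, e2, Matrix.mulVec_mulVec]
    · simp [propagator]

/-- Each coordinate of the deviation from the mean is a sum of martingale transforms. -/
lemma ae_deviation_apply (hX : IsPolyaUrnProcess U P X I) (hten : IsTenable U P X)
    (hbal : U.IsBalanced b) (hint : ∀ i j, Integrable (fun x : EuclideanSpace ℝ (Fin q) => x j)
      (U.replacement i : Measure (EuclideanSpace ℝ (Fin q)))) (i₀ : Fin q) (n : ℕ) :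
    ∀ᵐ ω ∂P, ∀ i, deviation P X n ω i =
      ∑ j, innovSum U X (fun x => x j) (U.coef b i₀ i j n) n ω := by
  filter_upwards [ae_deviation_eq_sum hX hten hbal hint n,
    ae_all_iff.2 fun k => ae_activity_dotProduct_innovVec hX hten hbal hint k] with ω h1 h2 i
  rw [h1, Finset.sum_apply]
  simp only [innovSum]
  rw [Finset.sum_comm]
  refine Finset.sum_congr rfl fun k _ => ?_
  conv_lhs => rw [← U.sum_smul_tangent i₀ (h2 k), Matrix.mulVec_sum, Finset.sum_apply]
  refine Finset.sum_congr rfl fun j _ => ?_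
  rw [Matrix.mulVec_smul, Pi.smul_apply, smul_eq_mul, mul_comm]
  rfl

end Urn


/-! ### Convergence of moments from convergence in distribution -/

/-- The function `‖x‖ ^ p`, cut off where `‖x‖ ≤ R`. -/
def normTail {E : Type*} [Norm E] (p R : ℝ) (x : E) : ℝ := if R < ‖x‖ then ‖x‖ ^ p else 0

section Tail

variable {E : Type*} [NormedAddCommGroup E] {p : ℝ}

lemma normTail_nonneg (p R : ℝ) (x : E) : 0 ≤ normTail p R x := by
  unfold normTail; split_ifs <;> positivity

lemma normTail_anti (p : ℝ) {R R' : ℝ} (h : R ≤ R') (x : E) :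
    normTail p R' x ≤ normTail p R x := by
  unfold normTail
  split_ifs with h1 h2 h2
  · exact le_rfl
  · exact absurd (h.trans_lt h1) h2
  · positivity
  · exact le_rfl

lemma normTail_le (p R : ℝ) (x : E) : normTail p R x ≤ ‖x‖ ^ p := by
  unfold normTail; split_ifs
  · exact le_rfl
  · positivity

lemma measurable_normTail [MeasurableSpace E] [OpensMeasurableSpace E] (p R : ℝ) :
    Measurable (normTail p R : E → ℝ) := by
  unfold normTail
  exact Measurable.ite (measurableSet_lt measurable_const measurable_norm)
    (measurable_norm.pow_const p) measurable_const

lemma integrable_normTail [MeasurableSpace E] [OpensMeasurableSpace E] {α : Type*}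
    [MeasurableSpace α] {μ : Measure α} {f : α → E} (hf : AEMeasurable f μ)
    (hi : Integrable (fun a => ‖f a‖ ^ p) μ) (R : ℝ) :
    Integrable (fun a => normTail p R (f a)) μ := by
  refine hi.mono' ((measurable_normTail p R).comp_aemeasurable hf).aestronglyMeasurable
    (ae_of_all _ fun a => ?_)
  rw [Real.norm_of_nonneg (normTail_nonneg _ _ _)]
  exact normTail_le _ _ _

lemma exists_integral_normTail_le [MeasurableSpace E] [OpensMeasurableSpace E] {α : Type*}
    [MeasurableSpace α] {μ : Measure α} {f : α → E} (hf : AEMeasurable f μ)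
    (hi : Integrable (fun a => ‖f a‖ ^ p) μ) {ε : ℝ} (hε : 0 < ε) :
    ∃ R : ℝ, ∫ a, normTail p R (f a) ∂μ ≤ ε := by
  have h : Tendsto (fun n : ℕ => ∫ a, normTail p n (f a) ∂μ) atTop (𝓝 (∫ _, (0 : ℝ) ∂μ)) := by
    refine tendsto_integral_of_dominated_convergence _
      (fun n => (integrable_normTail hf hi n).aestronglyMeasurable) hi
      (fun n => ae_of_all _ fun a => ?_) (ae_of_all _ fun a => ?_)
    · rw [Real.norm_of_nonneg (normTail_nonneg _ _ _)]
      exact normTail_le _ _ _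
    · refine tendsto_const_nhds.congr' ?_
      filter_upwards [eventually_ge_atTop ⌈‖f a‖⌉₊] with n hn
      rw [normTail, if_neg (not_lt.2 ((Nat.le_ceil _).trans (by exact_mod_cast hn)))]
  rw [integral_zero] at h
  obtain ⟨n, hn⟩ := (h.eventually (gt_mem_nhds hε)).exists
  exact ⟨n, hn.le⟩

/-- The cutoff at `1 + R ^ p` acts only where `R < ‖x‖`; there `1 ≤ ‖x‖ ^ p`, so `|f x| ≤ 2 * ‖x‖ ^
p`. -/
lemma abs_sub_cutoff_le (hp : 0 ≤ p) {f : E → ℝ} (hfp : ∀ x, |f x| ≤ 1 + ‖x‖ ^ p) {R : ℝ}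
    (hR : 1 ≤ R) (x : E) : |f x - max (-(1 + R ^ p)) (min (f x) (1 + R ^ p))| ≤
    2 * normTail p R x := by
  have hR0 : 0 ≤ R ^ p := by positivity
  rcases le_or_gt |f x| (1 + R ^ p) with h | h
  · rw [min_eq_left (abs_le.1 h).2, max_eq_right (abs_le.1 h).1, sub_self, abs_zero]
    have := normTail_nonneg p R x
    positivity
  · have hx : R < ‖x‖ := by
      by_contra! hle
      have := Real.rpow_le_rpow (norm_nonneg x) hle hp
      linarith [hfp x]
    have h1 : 1 ≤ ‖x‖ ^ p := Real.one_le_rpow (hR.trans hx.le) hp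
    rw [normTail, if_pos hx]
    refine le_trans ?_ ((hfp x).trans (by linarith))
    rcases le_or_gt 0 (f x) with h0 | h0
    · rw [abs_of_nonneg h0] at h ⊢
      rw [min_eq_right h.le, max_eq_right (by linarith), abs_of_nonneg (by linarith)]
      linarith
    · rw [abs_of_neg h0] at h ⊢
      rw [min_eq_left (by linarith), max_eq_left (by linarith), abs_of_neg (by linarith)]
      linarith

lemma abs_integral_sub_cutoff_le [MeasurableSpace E] [BorelSpace E] (hp : 0 ≤ p) {f : E → ℝ}
    (hf : Continuous f) (hfp : ∀ x, |f x| ≤ 1 + ‖x‖ ^ p) {α : Type*} [MeasurableSpace α]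
    (μ : Measure α) [IsProbabilityMeasure μ] {g : α → E} (hg : AEMeasurable g μ)
    (hi : Integrable (fun a => ‖g a‖ ^ p) μ) {R : ℝ} (hR : 1 ≤ R) :
    |∫ a, f (g a) ∂μ - ∫ a, max (-(1 + R ^ p)) (min (f (g a)) (1 + R ^ p)) ∂μ| ≤
      2 * ∫ a, normTail p R (g a) ∂μ := by
  have hR0 : 0 ≤ R ^ p := by positivity
  have i1 : Integrable (fun a => f (g a)) μ :=
    ((integrable_const (1 : ℝ)).add hi).mono'
      (hf.measurable.comp_aemeasurable hg).aestronglyMeasurable (ae_of_all _ fun a => hfp (g a))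
  have hc : Continuous fun x => max (-(1 + R ^ p)) (min (f x) (1 + R ^ p)) := by fun_prop
  have i2 : Integrable (fun a => max (-(1 + R ^ p)) (min (f (g a)) (1 + R ^ p))) μ := by
    refine Integrable.of_bound (C := 1 + R ^ p)
      (hc.measurable.comp_aemeasurable hg).aestronglyMeasurable (ae_of_all _ fun a => ?_)
    rw [Real.norm_eq_abs, abs_le]
    exact ⟨le_max_left _ _, max_le (by linarith) (min_le_right _ _)⟩
  rw [← integral_sub i1 i2, ← integral_const_mul]
  refine abs_integral_le_integral_abs.trans ?_
  exact integral_mono (i1.sub i2).abs ((integrable_normTail hg hi R).const_mul 2)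
    fun a => abs_sub_cutoff_le hp hfp hR (g a)

/-- Convergence in distribution, together with uniformly small tails of the `p`-th moments, implies
convergence of the means of continuous functions of growth at most `‖x‖ ^ p`. -/
lemma tendsto_integral_of_tendstoInDistribution [MeasurableSpace E] [BorelSpace E]
    {Ω : Type*} [MeasurableSpace Ω] {P : Measure Ω} [IsProbabilityMeasure P] {Z : ℕ → Ω → E}
    {ν : Measure E} [IsProbabilityMeasure ν]
    (hconv : TendstoInDistribution Z atTop id (fun _ => P) ν)
    (hp : 0 ≤ p) (hZ : ∀ n, Integrable (fun ω => ‖Z n ω‖ ^ p) P)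
    (hν : Integrable (fun x : E => ‖x‖ ^ p) ν)
    (htail : ∀ ε > 0, ∃ R : ℝ, ∀ n, ∫ ω, normTail p R (Z n ω) ∂P ≤ ε)
    {f : E → ℝ} (hf : Continuous f) (hfp : ∀ x, |f x| ≤ 1 + ‖x‖ ^ p) :
    Tendsto (fun n => ∫ ω, f (Z n ω) ∂P) atTop (𝓝 (∫ x, f x ∂ν)) := by
  have hZm := hconv.forall_aemeasurable
  have hcut : ∀ K : ℝ, 0 ≤ K → Tendsto (fun n => ∫ ω, max (-K) (min (f (Z n ω)) K) ∂P) atTop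
      (𝓝 (∫ x, max (-K) (min (f x) K) ∂ν)) := by
    intro K hK
    have hc : Continuous fun x => max (-K) (min (f x) K) := by fun_prop
    have h := ProbabilityMeasure.tendsto_iff_forall_integral_tendsto.1 hconv.tendsto
      (BoundedContinuousFunction.ofNormedAddCommGroup _ hc K fun x => by
        rw [Real.norm_eq_abs, abs_le]
        exact ⟨le_max_left _ _, max_le (by linarith) (min_le_right _ _)⟩)
    simp only [BoundedContinuousFunction.coe_ofNormedAddCommGroup, ProbabilityMeasure.coe_mk,
      Measure.map_id] at h
    refine h.congr fun n => ?_
    rw [integral_map (hZm n) hc.stronglyMeasurable.aestronglyMeasurable]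
  rw [Metric.tendsto_atTop]
  intro ε hε
  obtain ⟨R₀, hR₀⟩ := htail (ε / 8) (by positivity)
  obtain ⟨R₁, hR₁⟩ := exists_integral_normTail_le (f := fun x : E => x) aemeasurable_id hν
    (by positivity : 0 < ε / 8)
  set R := max 1 (max R₀ R₁) with hR
  have hR1 : 1 ≤ R := le_max_left _ _
  obtain ⟨N, hN⟩ := Metric.tendsto_atTop.1 (hcut (1 + R ^ p) (by positivity)) (ε / 4)
    (by positivity)
  refine ⟨N, fun n hn => ?_⟩
  have a1 := abs_integral_sub_cutoff_le hp hf hfp P (hZm n) (hZ n) hR1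
  have a2 := abs_integral_sub_cutoff_le (g := fun x => x) hp hf hfp ν aemeasurable_id hν hR1
  have a3 := hN n hn
  have t1 : ∫ ω, normTail p R (Z n ω) ∂P ≤ ε / 8 :=
    (integral_mono (integrable_normTail (hZm n) (hZ n) _) (integrable_normTail (hZm n) (hZ n) _)
      fun ω => normTail_anti p ((le_max_left _ _).trans (le_max_right _ _)) _).trans (hR₀ n)
  have t2 : ∫ x, normTail p R x ∂ν ≤ ε / 8 :=
    (integral_mono (integrable_normTail aemeasurable_id hν _)
      (integrable_normTail aemeasurable_id hν _)
      fun x => normTail_anti p ((le_max_right _ _).trans (le_max_right _ _)) _).trans hR₁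
  rw [Real.dist_eq] at a3 ⊢
  rw [abs_le] at a1 a2
  rw [abs_lt] at a3 ⊢
  constructor <;> linarith [a1.1, a1.2, a2.1, a2.2, a3.1, a3.2]

/-- A function bounded by a sum of a function with a small `p`-th moment and one with a bounded
`(p + 1)`-st moment has a small tail of the `p`-th moment. -/
lemma integral_normTail_le [MeasurableSpace E] [OpensMeasurableSpace E] {α : Type*}
    [MeasurableSpace α] {μ : Measure α} {f : α → E} (hf : AEMeasurable f μ) (hp : 0 ≤ p)
    (hi : Integrable (fun a => ‖f a‖ ^ p) μ) {V W : α → ℝ} (hV0 : ∀ a, 0 ≤ V a)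
    (hW0 : ∀ a, 0 ≤ W a) (hV : Integrable (fun a => V a ^ (p + 1)) μ)
    (hW : Integrable (fun a => W a ^ p) μ) (hle : ∀ᵐ a ∂μ, ‖f a‖ ≤ V a + W a) {R : ℝ}
    (hR : 0 < R) : ∫ a, normTail p R (f a) ∂μ ≤
      2 ^ (p + 1) / R * ∫ a, V a ^ (p + 1) ∂μ + 2 ^ p * ∫ a, W a ^ p ∂μ := by
  rw [← integral_const_mul, ← integral_const_mul,
    ← integral_add (hV.const_mul _) (hW.const_mul _)]
  refine integral_mono_ae (integrable_normTail hf hi R)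
    ((hV.const_mul _).add (hW.const_mul _)) ?_
  filter_upwards [hle] with a ha
  have hV' := hV0 a
  have hW' := hW0 a
  have n1 : 0 ≤ 2 ^ (p + 1) / R * V a ^ (p + 1) := by positivity
  have n2 : 0 ≤ 2 ^ p * W a ^ p := by positivity
  change normTail p R (f a) ≤ 2 ^ (p + 1) / R * V a ^ (p + 1) + 2 ^ p * W a ^ p
  unfold normTail
  split_ifs with h
  -- The larger of `V` and `W` controls `‖f‖` up to a factor 2; when it is `V`, the spare power of
  -- `‖f‖ > R` produces the factor `1 / R`.
  · rcases le_total (V a) (W a) with h1 | h1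
    · have : ‖f a‖ ^ p ≤ 2 ^ p * W a ^ p := by
        rw [← Real.mul_rpow zero_le_two hW']
        exact Real.rpow_le_rpow (norm_nonneg _) (by linarith) hp
      linarith
    · have hf0 : 0 < ‖f a‖ := hR.trans h
      have h2 : ‖f a‖ ^ (p + 1) ≤ 2 ^ (p + 1) * V a ^ (p + 1) := by
        rw [← Real.mul_rpow zero_le_two hV']
        exact Real.rpow_le_rpow (norm_nonneg _) (by linarith) (by linarith)
      have h3 : ‖f a‖ ^ p ≤ 2 ^ (p + 1) / R * V a ^ (p + 1) := by
        rw [div_mul_eq_mul_div, le_div_iff₀ hR]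
        refine le_trans ?_ h2
        rw [Real.rpow_add_one hf0.ne']
        gcongr
      linarith
  · linarith

end Tail


/-! ### Uniformly small tails for the normalized composition -/

lemma EuclideanSpace.norm_le_sum_abs {q : ℕ} (x : EuclideanSpace ℝ (Fin q)) :
    ‖x‖ ≤ ∑ i, |x i| := by
  rw [EuclideanSpace.norm_eq, Real.sqrt_le_left (Finset.sum_nonneg fun _ _ => abs_nonneg _)]
  simpa using Finset.sum_sq_le_sq_sum_of_nonneg (s := Finset.univ) (f := fun i => |x i|)
    fun _ _ => abs_nonneg _

lemma integrable_sum_abs_rpow {ι α : Type*} [Fintype ι] [MeasurableSpace α] {μ : Measure α}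
    {T : ι → α → ℝ} (hT : ∀ i, Measurable (T i)) {s D : ℝ} (hs : 1 ≤ s)
    (hi : ∀ i, Integrable (fun a => |T i a| ^ s) μ) (hD : ∀ i, ∫ a, |T i a| ^ s ∂μ ≤ D) :
    Integrable (fun a => (∑ i, |T i a|) ^ s) μ ∧
      ∫ a, (∑ i, |T i a|) ^ s ∂μ ≤ (Fintype.card ι : ℝ) ^ (s - 1) * (Fintype.card ι * D) := by
  have hb : ∀ a, (∑ i, |T i a|) ^ s ≤ (Fintype.card ι : ℝ) ^ (s - 1) * ∑ i, |T i a| ^ s :=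
    fun a => Real.rpow_sum_le_const_mul_sum_rpow Finset.univ (fun i => T i a) hs
  have hint : Integrable (fun a => (Fintype.card ι : ℝ) ^ (s - 1) * ∑ i, |T i a| ^ s) μ :=
    (integrable_finsetSum _ fun i _ => hi i).const_mul _
  have hI : Integrable (fun a => (∑ i, |T i a|) ^ s) μ := by
    refine hint.mono' ?_ (ae_of_all _ fun a => ?_)
    · fun_prop (disch := linarith)
    · rw [Real.norm_of_nonneg (by positivity)]
      exact hb a
  refine ⟨hI, (integral_mono hI hint hb).trans ?_⟩
  rw [integral_const_mul, integral_finsetSum _ fun i _ => hi i]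
  gcongr
  simpa using Finset.sum_le_card_nsmul Finset.univ _ D fun i _ => hD i

lemma PolyaUrn.exists_truncation {q : ℕ} (U : PolyaUrn q) {p : ℝ} (hp : 2 ≤ p)
    (hmom : U.HasFiniteMoments p) (j : Fin q) {ε : ℝ} (hε : 0 < ε) :
    ∃ f g : EuclideanSpace ℝ (Fin q) → ℝ, Measurable f ∧ Measurable g ∧
      (∀ x, x j = f x + g x) ∧ (∃ M, ∀ x, |f x| ≤ M) ∧
      (∀ i, Integrable (fun x => |g x| ^ p)
        (U.replacement i : Measure (EuclideanSpace ℝ (Fin q)))) ∧ U.absMoment g p ≤ ε := by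
  have hcoord : Measurable fun x : EuclideanSpace ℝ (Fin q) => x j := by fun_prop
  have hint : ∀ i, Integrable (fun x : EuclideanSpace ℝ (Fin q) => ‖x j‖ ^ p)
      (U.replacement i : Measure (EuclideanSpace ℝ (Fin q))) := fun i => hmom i j
  choose R hR using fun i => exists_integral_normTail_le hcoord.aemeasurable (hint i)
    (by positivity : 0 < ε / (q + 1))
  -- One truncation level above all the thresholds `R i`.
  set K := ∑ i, |R i| with hK
  have hgp : ∀ x : EuclideanSpace ℝ (Fin q), |if K < |x j| then x j else 0| ^ p =
      normTail p K (x j) := by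
    intro x
    unfold normTail
    rw [Real.norm_eq_abs]
    split_ifs
    · rfl
    · rw [abs_zero, Real.zero_rpow (by linarith)]
  refine ⟨fun x => if K < |x j| then 0 else x j, fun x => if K < |x j| then x j else 0,
    ?_, ?_, fun x => ?_, ⟨K, fun x => ?_⟩, fun i => ?_, ?_⟩
  · exact Measurable.ite (measurableSet_lt measurable_const hcoord.abs) measurable_const hcoord
  · exact Measurable.ite (measurableSet_lt measurable_const hcoord.abs) hcoord measurable_const
  · dsimp only
    split_ifs <;> simp
  · dsimp only
    split_ifs with h
    · rw [abs_zero]; positivity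
    · exact not_lt.1 h
  · simp_rw [hgp]
    exact integrable_normTail hcoord.aemeasurable (hint i) K
  · unfold PolyaUrn.absMoment
    simp_rw [hgp]
    calc _ ≤ ∑ _i : Fin q, ε / (q + 1) := by
          refine Finset.sum_le_sum fun i _ => le_trans ?_ (hR i)
          refine integral_mono (integrable_normTail hcoord.aemeasurable (hint i) K)
            (integrable_normTail hcoord.aemeasurable (hint i) _) fun x => normTail_anti p ?_ _
          exact (le_abs_self _).trans
            (Finset.single_le_sum (f := fun i => |R i|) (fun _ _ => abs_nonneg _)
              (Finset.mem_univ i))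
      _ = ε * (q / (q + 1)) := by simp; ring
      _ ≤ ε := mul_le_of_le_one_right hε.le (by
          rw [div_le_one (by positivity)]; linarith)

section Urn

variable {q : ℕ} {U : PolyaUrn q} {Ω : Type*} [mΩ : MeasurableSpace Ω] {P : Measure Ω}
  [IsProbabilityMeasure P] {X : ℕ → Ω → EuclideanSpace ℝ (Fin q)} {I : ℕ → Ω → Fin q} {b : ℝ}

lemma innovSum_add {f g h : EuclideanSpace ℝ (Fin q) → ℝ} (hh : ∀ x, h x = f x + g x)
    (hf : ∀ i, Integrable f (U.replacement i : Measure (EuclideanSpace ℝ (Fin q))))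
    (hg : ∀ i, Integrable g (U.replacement i : Measure (EuclideanSpace ℝ (Fin q))))
    (c : ℕ → ℝ) (n : ℕ) (ω : Ω) :
    innovSum U X h c n ω = innovSum U X f c n ω + innovSum U X g c n ω := by
  simp only [innovSum, ← Finset.sum_add_distrib, ← mul_add]
  refine Finset.sum_congr rfl fun k _ => ?_
  have : ∀ x, U.meanRepl h x = U.meanRepl f x + U.meanRepl g x := by
    intro x
    simp only [PolyaUrn.meanRepl, ← Finset.sum_add_distrib, ← mul_add, hh]
    exact Finset.sum_congr rfl fun i _ => by rw [integral_add (hf i) (hg i)]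
  simp only [PolyaUrn.innov, this, hh]
  ring

lemma integrable_coord_of_hasFiniteMoments {p : ℝ} (hp : 2 ≤ p) (hmom : U.HasFiniteMoments p)
    (i j : Fin q) : Integrable (fun x : EuclideanSpace ℝ (Fin q) => x j)
      (U.replacement i : Measure (EuclideanSpace ℝ (Fin q))) :=
  integrable_of_integrable_abs_rpow (by linarith : 1 ≤ p)
    (by fun_prop : Measurable fun x : EuclideanSpace ℝ (Fin q) => x j).aestronglyMeasurable
    (hmom i j)

lemma centredScaled_apply (hX : IsPolyaUrnProcess U P X I) (hten : IsTenable U P X)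
    (hint : ∀ i j, Integrable (fun x : EuclideanSpace ℝ (Fin q) => x j)
      (U.replacement i : Measure (EuclideanSpace ℝ (Fin q)))) (c : ℕ → ℝ) (n : ℕ) (ω : Ω)
    (i : Fin q) : centredScaled P X c n ω i = c n * (X n ω i - ∫ ω', X n ω' i ∂P) := by
  simp only [centredScaled, PiLp.smul_apply, PiLp.sub_apply, smul_eq_mul]
  rw [eval_integral_piLp fun j => integrable_coord hX hten hint n j]

lemma measurable_centredScaled (hX : IsPolyaUrnProcess U P X I) (c : ℕ → ℝ) (n : ℕ) :
    Measurable (centredScaled P X c n) :=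
  ((hX.measurable_composition n).sub_const _).const_smul (c n)

lemma ae_norm_centredScaled_le (hX : IsPolyaUrnProcess U P X I) (hten : IsTenable U P X)
    (hbal : U.IsBalanced b) (hint : ∀ i j, Integrable (fun x : EuclideanSpace ℝ (Fin q) => x j)
      (U.replacement i : Measure (EuclideanSpace ℝ (Fin q)))) (i₀ : Fin q) (c : ℕ → ℝ) (n : ℕ) :
    ∀ᵐ ω ∂P, ‖centredScaled P X c n ω‖ ≤ ∑ ij : Fin q × Fin q,
      |innovSum U X (fun x => x ij.2) (fun k => c n * U.coef b i₀ ij.1 ij.2 n k) n ω| := by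
  filter_upwards [ae_deviation_apply hX hten hbal hint i₀ n] with ω h
  refine (EuclideanSpace.norm_le_sum_abs _).trans ?_
  rw [Fintype.sum_prod_type]
  refine Finset.sum_le_sum fun i _ => ?_
  rw [centredScaled_apply hX hten hint]
  have h1 := h i
  unfold deviation at h1
  rw [h1, Finset.mul_sum]
  refine (Finset.abs_sum_le_sum_abs _ _).trans (le_of_eq ?_)
  refine Finset.sum_congr rfl fun j _ => ?_
  simp only [innovSum, Finset.mul_sum, mul_assoc]

/-- Truncation upgrades `L^p` boundedness to uniform integrability: the transforms of the bounded
parts `f j` are bounded in `L^(p+1)`, those of the remainders `g j` are small in `L^p`, both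
uniformly in `n`. -/
lemma integrable_centredScaled_and_tail (hX : IsPolyaUrnProcess U P X I)
    (hten : IsTenable U P X) (hbal : U.IsBalanced b) {p : ℝ} (hp : 2 ≤ p)
    (hmom : U.HasFiniteMoments p) {i₀ : Fin q} {c : ℕ → ℝ} {L : ℝ}
    (hL : ∀ i j n, ∑ k ∈ Finset.range n, (c n * U.coef b i₀ i j n k) ^ 2 ≤ L) :
    (∀ n, Integrable (fun ω => ‖centredScaled P X c n ω‖ ^ p) P) ∧
      ∀ ε > 0, ∃ R : ℝ, ∀ n, ∫ ω, normTail p R (centredScaled P X c n ω) ∂P ≤ ε := by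
  have hint := integrable_coord_of_hasFiniteMoments hp hmom
  have hp1 : 1 ≤ p := by linarith
  obtain ⟨K, hK, hKb⟩ := integral_abs_innovSum_rpow_le hX hten hp L
  obtain ⟨K', hK', hKb'⟩ := integral_abs_innovSum_rpow_le hX hten (by linarith : 2 ≤ p + 1) L
  have hmeas : ∀ {f : EuclideanSpace ℝ (Fin q) → ℝ} (_ : Measurable f) (c : ℕ → ℝ) (n : ℕ),
      Measurable (innovSum U X f c n) := fun hf c n =>
    (measurable_innovSum (I := I) n hf c).mono (urnHistory_le hX n) le_rfl
  have hZm := measurable_centredScaled hX (P := P) c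
  have hZ : ∀ n, Integrable (fun ω => ‖centredScaled P X c n ω‖ ^ p) P := by
    intro n
    have hb := fun ij : Fin q × Fin q => hKb (fun x => x ij.2) (by fun_prop)
      (fun i => hmom i ij.2) (fun k => c n * U.coef b i₀ ij.1 ij.2 n k) n (hL ij.1 ij.2 n)
    have h1 := (integrable_sum_abs_rpow (μ := P) (s := p)
      (D := ∑ ij : Fin q × Fin q, K * U.absMoment (fun x => x ij.2) p)
      (fun ij : Fin q × Fin q => hmeas (f := fun x => x ij.2) (by fun_prop)
        (fun k => c n * U.coef b i₀ ij.1 ij.2 n k) n) hp1 (fun ij => (hb ij).1)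
      (fun ij => (hb ij).2.trans (Finset.single_le_sum
        (f := fun ij : Fin q × Fin q => K * U.absMoment (fun x => x ij.2) p)
        (fun ij _ => mul_nonneg hK (U.absMoment_nonneg _ _)) (Finset.mem_univ ij)))).1
    refine h1.mono' ((hZm n).norm.pow_const p).aestronglyMeasurable ?_
    filter_upwards [ae_norm_centredScaled_le hX hten hbal hint i₀ c n] with ω h
    rw [Real.norm_of_nonneg (by positivity)]
    exact Real.rpow_le_rpow (norm_nonneg _) h (by linarith)
  refine ⟨hZ, fun ε hε => ?_⟩
  set N : ℝ := (Fintype.card (Fin q × Fin q) : ℝ) with hN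
  have hN0 : 0 ≤ N := by positivity
  set Q := 2 ^ p * (N ^ (p - 1) * (N * K)) with hQ
  have hQ0 : 0 ≤ Q := by positivity
  -- `Q` is the factor by which the remainder's moment gets multiplied, so this level keeps its
  -- contribution below `ε / 2`. The truncation is fixed before `R`, since the bound `B` depends on
  -- it.
  choose f g hf hg hfg hfM hgi hgε using fun j => U.exists_truncation hp hmom j
    (by positivity : 0 < ε / (2 * (Q + 1)))
  choose M hM using hfM
  have hfi : ∀ j i, Integrable (fun x => |f j x| ^ (p + 1))
      (U.replacement i : Measure (EuclideanSpace ℝ (Fin q))) := by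
    intro j i
    refine Integrable.of_bound (C := M j ^ (p + 1)) ?_ (ae_of_all _ fun x => ?_)
    · exact ((hf j).abs.pow_const _).aestronglyMeasurable
    · rw [Real.norm_of_nonneg (by positivity)]
      exact Real.rpow_le_rpow (abs_nonneg _) (hM j x) (by linarith)
  have hf1 : ∀ j i, Integrable (f j) (U.replacement i : Measure (EuclideanSpace ℝ (Fin q))) :=
    fun j i => integrable_of_integrable_abs_rpow (by linarith : 1 ≤ p + 1)
      (hf j).aestronglyMeasurable (hfi j i)
  have hg1 : ∀ j i, Integrable (g j) (U.replacement i : Measure (EuclideanSpace ℝ (Fin q))) :=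
    fun j i => integrable_of_integrable_abs_rpow hp1 (hg j).aestronglyMeasurable (hgi j i)
  set D := ∑ j, K' * U.absMoment (f j) (p + 1) with hD
  have hD0 : 0 ≤ D := Finset.sum_nonneg fun j _ => mul_nonneg hK' (U.absMoment_nonneg _ _)
  set B := 2 ^ (p + 1) * (N ^ (p + 1 - 1) * (N * D)) with hB
  have hB0 : 0 ≤ B := by positivity
  have hR : 0 < (B + 1) / (ε / 2) := by positivity
  refine ⟨(B + 1) / (ε / 2), fun n => ?_⟩
  have hbf := fun ij : Fin q × Fin q => hKb' (f ij.2) (hf _)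
    (fun i => hfi ij.2 i) (fun k => c n * U.coef b i₀ ij.1 ij.2 n k) n (hL ij.1 ij.2 n)
  have hbg := fun ij : Fin q × Fin q => hKb (g ij.2) (hg _)
    (fun i => hgi ij.2 i) (fun k => c n * U.coef b i₀ ij.1 ij.2 n k) n (hL ij.1 ij.2 n)
  obtain ⟨hV, hV'⟩ := integrable_sum_abs_rpow (μ := P) (s := p + 1) (D := D)
    (fun ij : Fin q × Fin q => hmeas (hf ij.2) (fun k => c n * U.coef b i₀ ij.1 ij.2 n k) n)
    (by linarith) (fun ij => (hbf ij).1)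
    (fun ij => (hbf ij).2.trans (Finset.single_le_sum
      (f := fun j => K' * U.absMoment (f j) (p + 1))
      (fun j _ => mul_nonneg hK' (U.absMoment_nonneg _ _)) (Finset.mem_univ ij.2)))
  obtain ⟨hW, hW'⟩ := integrable_sum_abs_rpow (μ := P) (s := p) (D := K * (ε / (2 * (Q + 1))))
    (fun ij : Fin q × Fin q => hmeas (hg ij.2) (fun k => c n * U.coef b i₀ ij.1 ij.2 n k) n)
    hp1 (fun ij => (hbg ij).1)
    (fun ij => (hbg ij).2.trans (mul_le_mul_of_nonneg_left (hgε ij.2) hK))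
  refine (integral_normTail_le (hZm n).aemeasurable (by linarith) (hZ n)
    (fun _ => Finset.sum_nonneg fun _ _ => abs_nonneg _)
    (fun _ => Finset.sum_nonneg fun _ _ => abs_nonneg _) hV hW ?_ hR).trans ?_
  · filter_upwards [ae_norm_centredScaled_le hX hten hbal hint i₀ c n] with ω h
    refine h.trans ?_
    rw [← Finset.sum_add_distrib]
    refine Finset.sum_le_sum fun ij _ => ?_
    rw [innovSum_add (hfg ij.2) (hf1 ij.2) (hg1 ij.2)]
    exact abs_add_le _ _
  · have e1 : 2 ^ (p + 1) / ((B + 1) / (ε / 2)) *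
        ∫ a, (∑ ij : Fin q × Fin q, |innovSum U X (f ij.2)
          (fun k => c n * U.coef b i₀ ij.1 ij.2 n k) n a|) ^ (p + 1) ∂P ≤ ε / 2 := by
      calc _ ≤ 2 ^ (p + 1) / ((B + 1) / (ε / 2)) * (N ^ (p + 1 - 1) * (N * D)) := by gcongr
        _ = ε / 2 * (B / (B + 1)) := by rw [hB]; field_simp
        _ ≤ ε / 2 := mul_le_of_le_one_right (by positivity) (by
            rw [div_le_one (by positivity)]; linarith)
    have e2 : 2 ^ p * ∫ a, (∑ ij : Fin q × Fin q, |innovSum U X (g ij.2)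
          (fun k => c n * U.coef b i₀ ij.1 ij.2 n k) n a|) ^ p ∂P ≤ ε / 2 := by
      calc _ ≤ 2 ^ p * (N ^ (p - 1) * (N * (K * (ε / (2 * (Q + 1)))))) := by gcongr
        _ = ε / 2 * (Q / (Q + 1)) := by rw [hQ]; field_simp
        _ ≤ ε / 2 := mul_le_of_le_one_right (by positivity) (by
            rw [div_le_one (by positivity)]; linarith)
    linarith

end Urn


/-! ### Moment convergence for the urn -/

lemma rpow_le_one_add_rpow {y s p : ℝ} (hy : 0 ≤ y) (hs : 0 ≤ s) (hsp : s ≤ p) :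
    y ^ s ≤ 1 + y ^ p := by
  rcases le_total y 1 with h | h
  · linarith [Real.rpow_le_one hy h hs, Real.rpow_nonneg hy p]
  · linarith [Real.rpow_le_rpow_of_exponent_le h hsp]

lemma prod_abs_rpow_le {q : ℕ} {p : ℝ} {r : Fin q → ℝ} (hr : ∀ i, 0 ≤ r i) (hrp : ∑ i, r i ≤ p)
    (x : EuclideanSpace ℝ (Fin q)) : ∏ i, |x i| ^ r i ≤ 1 + ‖x‖ ^ p := by
  calc ∏ i, |x i| ^ r i ≤ ∏ i, ‖x‖ ^ r i := by
        refine Finset.prod_le_prod (fun _ _ => by positivity) fun i _ => ?_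
        exact Real.rpow_le_rpow (abs_nonneg _) (PiLp.norm_apply_le x i) (hr i)
    _ = ‖x‖ ^ ∑ i, r i :=
        (Real.rpow_sum_of_nonneg (norm_nonneg x) fun i _ => hr i).symm
    _ ≤ _ := rpow_le_one_add_rpow (norm_nonneg x) (Finset.sum_nonneg fun i _ => hr i) hrp

section Urn

variable {q : ℕ} {U : PolyaUrn q} {Ω : Type*} [mΩ : MeasurableSpace Ω] {P : Measure Ω}
  [IsProbabilityMeasure P] {X : ℕ → Ω → EuclideanSpace ℝ (Fin q)} {I : ℕ → Ω → Fin q} {b : ℝ}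

/-- Every moment in question is the mean of a continuous function dominated by `1 + ‖x‖ ^ p`; the
covariances come from `x i * x j`, where `2 ≤ p` enters. -/
lemma momentsConverge_of_sum_coef_sq_le (hX : IsPolyaUrnProcess U P X I)
    (hten : IsTenable U P X) (hbal : U.IsBalanced b) {p : ℝ} (hp : 2 ≤ p)
    (hmom : U.HasFiniteMoments p) {S : Matrix (Fin q) (Fin q) ℝ} (hS : S.PosSemidef) {i₀ : Fin q}
    {c : ℕ → ℝ} {L : ℝ}
    (hL : ∀ i j n, ∑ k ∈ Finset.range n, (c n * U.coef b i₀ i j n k) ^ 2 ≤ L)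
    (hconv : TendstoInDistribution (centredScaled P X c) atTop id (fun _ => P)
      (multivariateGaussian 0 S)) :
    MomentsConverge P (centredScaled P X c) (multivariateGaussian 0 S) p ∧
      ∀ i j, Tendsto (fun n => c n ^ 2 * covariance (fun ω => X n ω i) (fun ω => X n ω j) P)
        atTop (𝓝 (S i j)) := by
  obtain ⟨hZ, htail⟩ := integrable_centredScaled_and_tail hX hten hbal hp hmom hL
  have hp0 : 0 ≤ p := by linarith
  have hpE : ENNReal.ofReal p ≠ 0 := by
    rw [Ne, ENNReal.ofReal_eq_zero]; linarith
  have hG : MemLp (id : EuclideanSpace ℝ (Fin q) → _) (ENNReal.ofReal p)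
      (multivariateGaussian 0 S) := IsGaussian.memLp_id _ _ ENNReal.ofReal_ne_top
  have hν : Integrable (fun x : EuclideanSpace ℝ (Fin q) => ‖x‖ ^ p)
      (multivariateGaussian 0 S) := by
    have h := (integrable_norm_rpow_iff hG.1 hpE ENNReal.ofReal_ne_top).2 hG
    rwa [ENNReal.toReal_ofReal hp0] at h
  have key : ∀ f : EuclideanSpace ℝ (Fin q) → ℝ, Continuous f → (∀ x, |f x| ≤ 1 + ‖x‖ ^ p) →
      Tendsto (fun n => ∫ ω, f (centredScaled P X c n ω) ∂P) atTop
        (𝓝 (∫ x, f x ∂(multivariateGaussian 0 S))) := fun f hf hfp =>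
    tendsto_integral_of_tendstoInDistribution hconv hp0 hZ hν htail hf hfp
  refine ⟨⟨fun n => ?_, hG, fun k hk => ?_, fun r hr hrp => ?_, fun r hr hrp => ?_⟩,
    fun i j => ?_⟩
  · rw [← integrable_norm_rpow_iff (measurable_centredScaled hX c n).aestronglyMeasurable hpE
      ENNReal.ofReal_ne_top, ENNReal.toReal_ofReal hp0]
    exact hZ n
  · refine key (fun x => ∏ i, x i ^ k i) (by fun_prop) fun x => ?_
    rw [Finset.abs_prod]
    have h := prod_abs_rpow_le (r := fun i => (k i : ℝ)) (fun i => Nat.cast_nonneg _)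
      (by simpa using hk) x
    simpa only [Real.rpow_natCast, abs_pow] using h
  · refine key (fun x => ‖x‖ ^ r) (continuous_norm.rpow_const fun _ => Or.inr hr.le) fun x => ?_
    rw [abs_of_nonneg (by positivity)]
    exact rpow_le_one_add_rpow (norm_nonneg x) hr.le hrp
  · refine key (fun x => ∏ i, |x i| ^ r i) ?_ fun x => ?_
    · exact continuous_finsetProd _ fun i _ =>
        (by fun_prop : Continuous fun x : EuclideanSpace ℝ (Fin q) => |x i|).rpow_const
          fun _ => Or.inr (hr i)
    · rw [abs_of_nonneg (Finset.prod_nonneg fun _ _ => by positivity)]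
      exact prod_abs_rpow_le hr hrp x
  · have h := key (fun x => x i * x j) (by fun_prop) fun x => by
      rw [abs_mul]
      refine le_trans ?_ (rpow_le_one_add_rpow (norm_nonneg x) zero_le_two hp)
      rw [Real.rpow_two, sq]
      exact mul_le_mul (PiLp.norm_apply_le x i) (PiLp.norm_apply_le x j) (abs_nonneg _)
        (norm_nonneg _)
    have hlim : ∫ x : EuclideanSpace ℝ (Fin q), x i * x j ∂(multivariateGaussian 0 S) = S i j := by
      rw [← covariance_eval_multivariateGaussian (μ := 0) hS i j, covariance]
      have h0 : ∀ i, ∫ x : EuclideanSpace ℝ (Fin q), x i ∂(multivariateGaussian 0 S) = 0 := by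
        intro i
        rw [← eval_integral_piLp (f := fun x : EuclideanSpace ℝ (Fin q) => x) (fun i => ?_) i]
        · simp
        · exact (EuclideanSpace.proj i : EuclideanSpace ℝ (Fin q) →L[ℝ] ℝ).integrable_comp
            IsGaussian.integrable_id
      simp only [h0, sub_zero]
    rw [hlim] at h
    refine h.congr fun n => ?_
    rw [covariance, ← integral_const_mul]
    refine integral_congr_ae (ae_of_all _ fun ω => ?_)
    have hint := integrable_coord_of_hasFiniteMoments hp hmom
    simp only [centredScaled_apply hX hten hint]
    ring

lemma exists_activity_ne_zero (hX : IsPolyaUrnProcess U P X I) (hten : IsTenable U P X) :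
    ∃ i₀, U.activity i₀ ≠ 0 := by
  by_contra! h
  have := weight_initial_pos hX hten
  simp [PolyaUrn.weight, h] at this

end Urn

/-- The strict gap after the first eigenvalue makes it simple, and the ordering bounds all others by
the second, lexicographically in real part and `jordanNu`. -/
lemma IsOrderedEigenvalues.count_and_others {q : ℕ} {A : Matrix (Fin q) (Fin q) ℂ}
    {lam : Fin q → ℂ} {i₀ i₁ : Fin q} (hi₀ : i₀.val = 0) (hi₁ : i₁.val = 1)
    (h : IsOrderedEigenvalues A lam) (hlt : (lam i₁).re < (lam i₀).re) :
    A.charpoly.roots.count (lam i₀) = 1 ∧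
      ∀ μ ∈ A.charpoly.roots, μ ≠ lam i₀ → μ.re < (lam i₁).re ∨
        μ.re = (lam i₁).re ∧ jordanNu A μ ≤ jordanNu A (lam i₁) := by
  have hone : ∀ i : Fin q, i ≠ i₀ → i₁ ≤ i := by
    intro i hi
    rw [Fin.le_def]
    have : i.val ≠ 0 := fun h0 => hi (Fin.ext (h0.trans hi₀.symm))
    omega
  constructor
  · rw [← h.roots, Multiset.count_map]
    change (Finset.univ.filter fun i => lam i₀ = lam i).card = 1
    rw [Finset.card_eq_one]
    refine ⟨i₀, ?_⟩
    ext i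
    simp only [Finset.mem_filter, Finset.mem_univ, true_and, Finset.mem_singleton]
    refine ⟨fun hi => ?_, fun hi => by rw [hi]⟩
    by_contra hne
    have := h.re_anti _ _ (hone i hne)
    rw [← hi] at this
    linarith
  · intro μ hμ hne
    rw [← h.roots, Multiset.mem_map] at hμ
    obtain ⟨i, -, rfl⟩ := hμ
    have hi := hone i fun hi => hne (by rw [hi])
    rcases (h.re_anti _ _ hi).lt_or_eq with hlt' | heq
    · exact Or.inl hlt'
    · exact Or.inr ⟨heq, h.nu_anti _ _ hi heq⟩

lemma PolyaUrn.hasGrowth_tangent {q : ℕ} (U : PolyaUrn q) {b : ℝ} (hbal : U.IsBalanced b)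
    (hw : 0 < U.weight U.initial)
    (hint : ∀ i j, Integrable (fun x : EuclideanSpace ℝ (Fin q) => x j)
      (U.replacement i : Measure (EuclideanSpace ℝ (Fin q)))) {i₀ : Fin q}
    (hi₀ : U.activity i₀ ≠ 0) (hcount : U.intensityC.charpoly.roots.count (b : ℂ) = 1)
    {σ : ℝ} {κ : ℕ} (hroots : ∀ μ ∈ U.intensityC.charpoly.roots, μ ≠ (b : ℂ) →
      μ.re < σ ∨ μ.re = σ ∧ jordanNu U.intensityC μ ≤ κ) (j : Fin q) :
    HasGrowth U.intensityC (invWeight (U.weight U.initial) b) σ κ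
      fun i => (U.tangent i₀ j i : ℂ) := by
  refine hasGrowth_of_dotProduct_eq_zero (fun k => (invWeight_pos hw hbal.1 k).le)
    (invWeight_le hw hbal.1) (stepSum_invWeight_sq_le hw hbal.1)
    (a := fun i => (U.activity i : ℂ)) (b := b) ?_ ?_ hcount hroots ?_
  · intro h
    exact hi₀ (Complex.ofReal_eq_zero.1 (congrFun h i₀))
  · ext k
    have h1 := RingHom.map_vecMul (algebraMap ℝ ℂ) U.intensity U.activity k
    rw [U.vecMul_intensity hbal hint] at h1
    exact h1.symm.trans (by simp)
  · have h1 := RingHom.map_dotProduct (algebraMap ℝ ℂ) U.activity (U.tangent i₀ j)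
    rw [U.activity_dotProduct_tangent hi₀] at h1
    exact h1.symm.trans (by simp)

lemma PolyaUrn.sum_coef_sq_le {q : ℕ} (U : PolyaUrn q) {b : ℝ} (hb : 0 < b)
    (hw : 0 < U.weight U.initial) {i₀ : Fin q} {σ : ℝ} {κ : ℕ}
    (hg : ∀ j, HasGrowth U.intensityC (invWeight (U.weight U.initial) b) σ κ
      fun i => (U.tangent i₀ j i : ℂ)) {c s : ℕ → ℝ} (hs : ∀ n, 0 ≤ s n)
    (hc : ∀ n, c n = (√(s n))⁻¹) {L : ℝ} (hL0 : 0 ≤ L)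
    (hL : ∀ n, s n ≠ 0 →
      ∑ k ∈ Finset.range n, growthFactor (U.weight U.initial) b σ κ n k ^ 2 ≤ L * s n) :
    ∃ L', ∀ i j n, ∑ k ∈ Finset.range n, (c n * U.coef b i₀ i j n k) ^ 2 ≤ L' := by
  obtain ⟨C, hC, hCb⟩ := U.abs_coef_le hw hb hg
  refine ⟨C ^ 2 * L, fun i j n => ?_⟩
  have hc2 : c n ^ 2 = (s n)⁻¹ := by rw [hc, inv_pow, Real.sq_sqrt (hs n)]
  simp only [mul_pow, hc2, ← Finset.mul_sum]
  -- Where the normalizer vanishes, its inverse is 0 by convention and so are all coefficients.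
  rcases eq_or_ne (s n) 0 with h0 | h0
  · rw [h0, inv_zero, zero_mul]; positivity
  · have hsn : 0 < s n := lt_of_le_of_ne (hs n) h0.symm
    rw [inv_mul_le_iff₀ hsn]
    calc _ ≤ ∑ k ∈ Finset.range n,
          C ^ 2 * growthFactor (U.weight U.initial) b σ κ n k ^ 2 := by
          refine Finset.sum_le_sum fun k _ => ?_
          rw [← mul_pow, ← sq_abs]
          exact pow_le_pow_left₀ (abs_nonneg _) (hCb i j n k) 2
      _ ≤ C ^ 2 * (L * s n) := by rw [← Finset.mul_sum]; gcongr; exact hL n h0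
      _ = _ := by ring

end

theorem mainTheorem5 {q : ℕ} (hq : 2 ≤ q) (U : PolyaUrn q)
    {Ω : Type*} [MeasurableSpace Ω] (P : Measure Ω) [IsProbabilityMeasure P]
    (X : ℕ → Ω → EuclideanSpace ℝ (Fin q)) (I : ℕ → Ω → Fin q)
    (hX : IsPolyaUrnProcess U P X I) (hten : IsTenable U P X)
    (b : ℝ) (hbal : U.IsBalanced b)
    (lam : Fin q → ℂ) (hlam : IsOrderedEigenvalues U.intensityC lam)
    (lam₁ lam₂ : ℂ) (hlam₁ : lam₁ = lam ⟨0, by omega⟩) (hlam₂ : lam₂ = lam ⟨1, by omega⟩)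
    (hb : lam₁ = (b : ℂ))
    (p : ℝ) (hp : 2 ≤ p) (hmom : U.HasFiniteMoments p)
    (S : Matrix (Fin q) (Fin q) ℝ) (hS : S.PosSemidef) :
    (lam₂.re < lam₁.re / 2 →
      TendstoInDistribution (centredScaled P X fun n => (√(n : ℝ))⁻¹) atTop id
        (fun _ => P) (multivariateGaussian 0 S) →
      MomentsConverge P (centredScaled P X fun n => (√(n : ℝ))⁻¹)
        (multivariateGaussian 0 S) p ∧
      ∀ i j, Tendsto (fun n : ℕ => covariance (fun ω => X n ω i) (fun ω => X n ω j) P / (n : ℝ))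
        atTop (𝓝 (S i j))) ∧
    (lam₂.re = lam₁.re / 2 →
      TendstoInDistribution
        (centredScaled P X fun n =>
          (√((n : ℝ) * Real.log n ^ (2 * jordanNu U.intensityC lam₂ + 1)))⁻¹)
        atTop id (fun _ => P) (multivariateGaussian 0 S) →
      MomentsConverge P
        (centredScaled P X fun n =>
          (√((n : ℝ) * Real.log n ^ (2 * jordanNu U.intensityC lam₂ + 1)))⁻¹)
        (multivariateGaussian 0 S) p ∧
      ∀ i j, Tendsto (fun n : ℕ => covariance (fun ω => X n ω i) (fun ω => X n ω j) P /
          ((n : ℝ) * Real.log n ^ (2 * jordanNu U.intensityC lam₂ + 1)))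
        atTop (𝓝 (S i j))) := by

  subst hlam₁ hlam₂
  have hb0 := hbal.1
  have hw := weight_initial_pos hX hten
  have hint := integrable_coord_of_hasFiniteMoments hp hmom
  obtain ⟨i₀, hi₀⟩ := exists_activity_ne_zero hX hten
  have hbre : (lam ⟨0, by omega⟩).re = b := by rw [hb, Complex.ofReal_re]
  rw [hbre]
  constructor
  · intro hlt hconv
    obtain ⟨hcount, hothers⟩ := hlam.count_and_others (i₀ := ⟨0, by omega⟩)
      (i₁ := ⟨1, by omega⟩) rfl rfl (by linarith)
    rw [hb] at hcount
    rw [hb] at hothers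
    set ρ := (lam ⟨1, by omega⟩).re
    -- Strictly above `ρ`, so that Jordan polynomials are absorbed and `κ = 0` suffices;
    -- nonnegative, as the summation lemma requires.
    obtain ⟨σ, hσ1, hσ2⟩ := exists_between (max_lt hlt (by positivity : 0 < b / 2))
    have hg := U.hasGrowth_tangent hbal hw hint hi₀ hcount (σ := σ) (κ := 0) fun μ hμ hne =>
      Or.inl (by
        rcases hothers μ hμ hne with h | h
        · linarith [le_max_left ρ 0]
        · linarith [le_max_left ρ 0, h.1])
    obtain ⟨L, hL0, hL⟩ := sum_growthFactor_sq_le_small hw hb0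
      ((le_max_right ρ 0).trans hσ1.le) hσ2
    obtain ⟨L', hL'⟩ := U.sum_coef_sq_le hb0 hw hg (s := fun n => (n : ℝ))
      (fun n => Nat.cast_nonneg n) (c := fun n => (√(n : ℝ))⁻¹) (fun _ => rfl) hL0
      fun n hn => hL n (Nat.one_le_iff_ne_zero.2 (by exact_mod_cast hn))
    obtain ⟨h1, h2⟩ := momentsConverge_of_sum_coef_sq_le hX hten hbal hp hmom hS hL' hconv
    refine ⟨h1, fun i j => (h2 i j).congr fun n => ?_⟩
    rw [inv_pow, Real.sq_sqrt (Nat.cast_nonneg n), inv_mul_eq_div]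
  · intro heq hconv
    obtain ⟨hcount, hothers⟩ := hlam.count_and_others (i₀ := ⟨0, by omega⟩)
      (i₁ := ⟨1, by omega⟩) rfl rfl (by linarith)
    rw [hb] at hcount
    rw [hb] at hothers
    rw [heq] at hothers
    have hg := U.hasGrowth_tangent hbal hw hint hi₀ hcount hothers
    set ν := jordanNu U.intensityC (lam ⟨1, by omega⟩)
    obtain ⟨L, hL0, hL⟩ := sum_growthFactor_sq_le_critical hw hb0 ν
    have hs : ∀ n : ℕ, 0 ≤ (n : ℝ) * Real.log n ^ (2 * ν + 1) := fun n =>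
      mul_nonneg (Nat.cast_nonneg n) (pow_nonneg (Real.log_natCast_nonneg n) _)
    obtain ⟨L', hL'⟩ := U.sum_coef_sq_le hb0 hw hg hs
      (c := fun n => (√((n : ℝ) * Real.log n ^ (2 * ν + 1)))⁻¹) (fun _ => rfl) hL0
      fun n hn => hL n (by
        -- The normalizer is zero at `n = 0` and at `n = 1`, where `log 1 = 0`.
        by_contra! hlt
        interval_cases n <;> simp at hn)
    obtain ⟨h1, h2⟩ := momentsConverge_of_sum_coef_sq_le hX hten hbal hp hmom hS hL' hconv
    refine ⟨h1, fun i j => (h2 i j).congr fun n => ?_⟩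
    rw [inv_pow, Real.sq_sqrt (hs n), inv_mul_eq_div]
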